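/- Write $G_n$ for the graph on $n+1$ vertices $a, v_1, \dots, v_n$ whose $2n-1$ edges are $\{a, v_i\}$ for $1 \le i \le n$ and $\{v_i, v_{i+1}\}$ for $1 \le i < n$. Let $H$ be Hollom's $3$-uniform hypergraph on $\{u_1, \dots, u_{10}\}$ with the six hyperedges $$\{u_1,u_2,u_3\},\ \{u_3,u_6,u_9\},\ \{u_5,u_6,u_7\},\ \{u_2,u_4,u_5\},\ \{u_4,u_7,u_8\},\ \{u_8,u_9,u_{10}\},$$ and let $T = \{u_2, u_7, u_9\}$; each hyperedge contains exactly one vertex of $T$. For a finite connected simple graph $G=(V,E)$, a set $T \subseteq V$ of transversal vertices and $p \in [0,1]$, bunkbed percolation is the following random graph. Take two copies of $G$, with vertex sets $V$ and $V' = \{w' : w \in V\}$. Each edge of the two copies is retained independently with probability $p$ and deleted otherwise, and all posts $\{w, w'\}$ with $w \in T$ are present. Let $\mathbb{P}^{\mathrm{bb}}_p[x \leftrightarrow y]$ be the probability that $x, y \in V \cup V'$ are connected in this random graph. **Theorem.** Let $G$ be the graph obtained from $H$ by replacing each hyperedge $\{a,b,c\}$, where $a \in T$, with its own copy of $G_n$,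 $n = 1204$, in which the vertex $a$ of $G_n$ is identified with $a$, $v_1$ with $b$ and $v_n$ with $c$. Then $G$ is a connected planar graph with $7222$ vertices and $14442$ edges, and with the three transversal vertices $T = \{u_2,u_7,u_9\}$ and $u = u_1$, $v = u_{10}$ one has $$\mathbb{P}^{\mathrm{bb}}_{1/2}[u \leftrightarrow v] < \mathbb{P}^{\mathrm{bb}}_{1/2}[u \leftrightarrow v'].$$ In particular, the bunkbed conjecture is false: it is not true that for every finite connected simple graph $G = (V,E)$, every $T \subseteq V$, every $0 < p < 1$ and all $u, v \in V$ one has $\mathbb{P}^{\mathrm{bb}}_p[u \leftrightarrow v] \ge \mathbb{P}^{\mathrm{bb}}_p[u \leftrightarrow v']$. -/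

import Mathlib

open MeasureTheory ProbabilityTheory

/-! ## Planar graphs -/

/-- A graph is planar if it can be drawn in the plane `ℝ²`: vertices are distinct points, every edge
is a simple arc joining the points of its two ends, the interior of an arc contains no vertex, and
the interiors of the arcs of different edges are disjoint. -/
def IsPlanar {V : Type*} (G : SimpleGraph V) : Prop :=
  ∃ (pt : V → ℝ × ℝ) (arc : G.edgeSet → unitInterval → ℝ × ℝ),
    Function.Injective pt ∧
    (∀ e, Continuous (arc e)) ∧
    (∀ e, Function.Injective (arc e)) ∧
    (∀ e, s(arc e 0, arc e 1) = Sym2.map pt e.1) ∧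
    (∀ e, ∀ t, 0 < t → t < 1 → ∀ w, arc e t ≠ pt w) ∧
    (∀ e f, e ≠ f → ∀ s t, 0 < s → s < 1 → 0 < t → t < 1 → arc e s ≠ arc f t)

/-! ## Bunkbed percolation

The vertices of the bunkbed graph are the pairs in `V × Bool`: the pair `(w, false)` is the vertex
`w` of the lower copy of `G`, and `(w, true)` is the corresponding vertex `w'` of the upper copy. -/

/-- The edges of the two copies of `G`, that is `E ∪ E'`. -/
def levelEdges {V : Type*} (G : SimpleGraph V) : Set (Sym2 (V × Bool)) :=
  {e | ∃ e₀ ∈ G.edgeSet, ∃ i : Bool, e = Sym2.map (fun w => (w, i)) e₀}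

/-- The posts: the edges `{w, w'}` for the transversal vertices `w ∈ T`. -/
def posts {V : Type*} (T : Set V) : Set (Sym2 (V × Bool)) :=
  {e | ∃ w ∈ T, e = s((w, false), (w, true))}

/-- The random subgraph of the bunkbed graph whose retained level edges are those in `S`; all
posts are retained. -/
def retainedGraph {V : Type*} (T : Set V) (S : Set (Sym2 (V × Bool))) : SimpleGraph (V × Bool) :=
  SimpleGraph.fromEdgeSet (S ∪ posts T)

/-- The probability that `x` and `y` are connected in bunkbed percolation: every edge of the two
copies of `G` is retained independently with probability `p`, and all posts are retained. -/
noncomputable def bunkbedProb {V : Type*} (G : SimpleGraph V) (T : Set V) (p : unitInterval)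
    (x y : V × Bool) : ℝ :=
  (setBernoulli (levelEdges G) p).real {S | (retainedGraph T S).Reachable x y}

/-- The bunkbed conjecture, for all finite connected simple graphs. -/
def BunkbedConjecture : Prop :=
  ∀ (V : Type) [Finite V] (G : SimpleGraph V), G.Connected →
    ∀ (T : Set V) (p : unitInterval), 0 < p → p < 1 → ∀ u v : V,
      bunkbedProb G T p (u, false) (v, true) ≤ bunkbedProb G T p (u, false) (v, false)

/-! ## The graph -/

/-- The gadget `G_n`: a vertex `a` (the vertex `none`) joined to every vertex of a path
`v_1, …, v_n` (the vertex `some i` is `v_{i+1}`). -/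
def gadget (n : ℕ) : SimpleGraph (Option (Fin n)) :=
  SimpleGraph.fromRel fun x y =>
    match x, y with
    | none, some _ => True
    | some i, some j => i.val + 1 = j.val
    | _, _ => False

/-- The six hyperedges of Hollom's hypergraph on `u_1, …, u_10`, where `i : Fin 10` stands for
`u_{i+1}`. Each hyperedge is listed as `(a, b, c)` with `a` its transversal vertex:
`{u_2, u_1, u_3}, {u_9, u_3, u_6}, {u_7, u_6, u_5}, {u_2, u_5, u_4}, {u_7, u_4, u_8},
{u_9, u_8, u_10}`. -/
def hollomEdge : Fin 6 → Fin 10 × Fin 10 × Fin 10 :=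
  ![(1, 0, 2), (8, 2, 5), (6, 5, 4), (1, 4, 3), (6, 3, 7), (8, 7, 9)]

/-- Vertices after replacing each hyperedge by a copy of `G_n`: the ten vertices of the hypergraph,
and, for each hyperedge, the `n - 2` vertices `v_2, …, v_{n-1}` of its own copy. -/
abbrev HollomVertex (n : ℕ) : Type := Fin 10 ⊕ (Fin 6 × Fin (n - 2))

/-- The position of the copy of `G_n` that replaces the hyperedge `e = {a, b, c}`: the vertex `a` of
the gadget goes to `a`, `v_1` to `b` and `v_n` to `c`, and the other vertices are new. -/
def place (n : ℕ) (e : Fin 6) : Option (Fin n) → HollomVertex n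
  | none => Sum.inl (hollomEdge e).1
  | some i =>
    if h₁ : i.val = 0 then Sum.inl (hollomEdge e).2.1
    else if h₂ : i.val + 1 = n then Sum.inl (hollomEdge e).2.2
    else Sum.inr (e, ⟨i.val - 1, by have := i.isLt; omega⟩)

/-- Hollom's hypergraph with each hyperedge replaced by the gadget `G_n`. -/
def hollomGraph (n : ℕ) : SimpleGraph (HollomVertex n) :=
  SimpleGraph.fromRel fun x y =>
    ∃ (e : Fin 6) (s t : Option (Fin n)), (gadget n).Adj s t ∧ place n e s = x ∧ place n e t = y

/-- The transversal vertices `u_2, u_7, u_9`. -/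
def hollomT (n : ℕ) : Set (HollomVertex n) :=
  {Sum.inl 1, Sum.inl 6, Sum.inl 8}

/-! ## Product sums and the uniform random subset -/

/-! Outside its three terminals a copy of the gadget matters only through the partition it induces
on them. The bunkbed graph thus reduces to Hollom's hypergraph whose six hyperedges carry
independent pairs of states, one per level, and the difference of the two probabilities is
`meanExcess` of the state distribution (`bunkbedProb_sub`).

The non-transversal vertices form a chain u_1, u_3, u_6, u_5, u_4, u_8, u_10 whose consecutive links
are the six hyperedges, and the posts identify the two copies of each transversal vertex. Twisting a
hyperedge therefore amounts to exchanging the levels on the rest of the chain, which preserves the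
weights and negates the excess. Summing over all 64 choices of twists with signs gives `64 *
meanExcess` (`sum_twistWeight_excess`).

In the signed sum, states of a hyperedge that make the same joins cancel (`sum_twistWeight_mul`).
Apart from states with a level in the partition a|bc, only those remain in which a is joined to b on
exactly one level and to c on exactly one level; they have weight ±δ, where δ = P(abc)P(a|b|c) -
P(ab|c)P(ac|b). On these the excess can be computed exactly, and they contribute -64 δ^6
(`sum_mainWeight`). With κ = P(a|bc), the other terms contribute at most (4δ + 4κ)^6 - (4δ)^6 in
absolute value (`abs_sum_prod_add_sub_le`), which is less than 64 δ^6 when δ ≥ 400 κ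
(`meanExcess_neg`).

For the gadget, lengthening the path by one vertex divides κ by 4 and sends δ to at least δ/4 + (4/3
- κ)κ/16. So δ/κ grows by about 1/3 or more at each step (`triDist_bounds`), and a path of 1204
vertices suffices. -/

theorem sum_pi_prod_comp {ι Q L R : Type*} [Fintype ι] [DecidableEq ι] [Fintype Q] [Fintype L]
    [DecidableEq L] [CommSemiring R] (w : Q → R) (loc : Q → L) (F : (ι → L) → R) :
    ∑ q : ι → Q, (∏ i, w (q i)) * F (fun i => loc (q i)) =
      ∑ l : ι → L, (∏ i, ∑ q with loc q = l i, w q) * F l := by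
  classical
  rw [← Finset.sum_fiberwise (s := Finset.univ) (g := fun (q : ι → Q) i => loc (q i))]
  refine Finset.sum_congr rfl fun l _ => ?_
  rw [Finset.prod_univ_sum, Finset.sum_mul]
  refine Finset.sum_congr ?_ fun q hq => ?_
  · ext q
    simp [funext_iff]
  · congr 2
    funext i
    simp only [Fintype.mem_piFinset, Finset.mem_filter, Finset.mem_univ, true_and] at hq
    exact hq i

/-- A product sum depends only on the image of the local weight under `loc`, by grouping each
coordinate into the fibres of `loc`. The weights may be signed, so this performs both the passage
from configurations to states and the cancellation between twisted states. -/
theorem sum_pi_prod_congr {ι Q Q' L R : Type*} [Fintype ι] [DecidableEq ι] [Fintype Q]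
    [Fintype Q'] [Fintype L] [DecidableEq L] [CommSemiring R] {w : Q → R} {w' : Q' → R}
    {loc : Q → L} {loc' : Q' → L}
    (h : ∀ g : L → R, ∑ q, w q * g (loc q) = ∑ q, w' q * g (loc' q)) (F : (ι → L) → R) :
    ∑ q : ι → Q, (∏ i, w (q i)) * F (fun i => loc (q i)) =
      ∑ q : ι → Q', (∏ i, w' (q i)) * F (fun i => loc' (q i)) := by
  rw [sum_pi_prod_comp, sum_pi_prod_comp]
  refine Finset.sum_congr rfl fun l _ => ?_
  congr 1
  refine Finset.prod_congr rfl fun i _ => ?_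
  simpa [Finset.sum_filter] using h fun x => if x = l i then 1 else 0

/-- At p = 1/2 retained and deleted edges have equal weight, so all subsets are equally likely and
the probability is a count. -/
theorem setBernoulli_half_real {ι E : Type*} [Countable ι] [Fintype E] [DecidableEq E] {f : E → ι}
    (hf : Function.Injective f) {p : unitInterval} (hp : (p : ℝ) = 1 / 2) (A : Set (Set ι))
    [∀ ω : E → Bool, Decidable (f '' {e | ω e = true} ∈ A)] :
    (setBernoulli (Set.range f) p).real A =
      (∑ ω : E → Bool, if f '' {e | ω e = true} ∈ A then 1 else 0) / 2 ^ Fintype.card E := by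
  classical
  have hfin : (Set.range f).Finite := Set.finite_range f
  have hinj : Function.Injective fun ω : E → Bool => f '' {e | ω e = true} := by
    intro ω ω' h
    have h' := hf.image_injective h
    funext e
    have := Set.ext_iff.1 h' e
    exact Bool.eq_iff_iff.2 this
  have hA : {S ∈ A | S ⊆ Set.range f} =
      ⋃ ω ∈ Finset.univ.filter fun ω : E → Bool => f '' {e | ω e = true} ∈ A,
        {f '' {e | ω e = true}} := by
    ext S
    simp only [Set.mem_ofPred_eq, Finset.mem_filter, Finset.mem_univ, true_and, Set.mem_iUnion,
      Set.mem_singleton_iff, exists_prop]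
    constructor
    · rintro ⟨h, hS⟩
      have : f '' {e | decide (f e ∈ S) = true} = S := by
        ext x
        simp only [decide_eq_true_eq, Set.mem_image, Set.mem_ofPred_eq]
        constructor
        · rintro ⟨e, he, rfl⟩
          exact he
        · intro hx
          obtain ⟨e, rfl⟩ := hS hx
          exact ⟨e, hx, rfl⟩
      exact ⟨fun e => decide (f e ∈ S), by rwa [this], this.symm⟩
    · rintro ⟨ω, h, rfl⟩
      exact ⟨h, Set.image_subset_range _ _⟩
  have hw : ∀ ω : E → Bool, (setBernoulli (Set.range f) p).real {f '' {e | ω e = true}} =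
      1 / 2 ^ Fintype.card E := by
    intro ω
    have hsub := Set.image_subset_range f {e | ω e = true}
    rw [setBernoulli_real_singleton p hsub hfin, hp]
    norm_num
    rw [← pow_add, Set.ncard_sdiff' hsub hfin, Nat.add_sub_cancel' (Set.ncard_le_ncard hsub hfin),
      ← Set.image_univ, Set.ncard_image_of_injective _ hf, Set.ncard_univ, Nat.card_eq_fintype_card, one_div, inv_pow]
  rw [measureReal_def, setBernoulli_apply_eq_apply_subsets, ← measureReal_def, hA,
    measureReal_biUnion_finset]
  · simp_rw [hw]
    simp [div_eq_mul_inv]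
  · intro ω _ ω' _ h
    simpa [Function.onFun] using fun h' => h (hinj h')
  · intro ω _
    exact MeasurableSet.singleton _

/-! ## Local states of a hyperedge and the reduced bunkbed graph -/

/-- The partition of `{a, b, c}` induced by a configuration of one copy of a gadget: `none` is
`a | bc`, and `some (x, y)` tells whether `b` and `c` are joined to `a`. -/
abbrev TriState : Type := Option (Bool × Bool)

/-- Whether `b` is joined to `a`. -/
def TriState.left : TriState → Bool
  | none => false
  | some x => x.1

/-- Whether `c` is joined to `a`. -/
def TriState.right : TriState → Bool
  | none => false
  | some x => x.2

/-- The states of the two levels of a hyperedge, and whether its `c`-end is twisted, which swaps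
`c` and `c'`. -/
abbrev TwistedState : Type := (TriState × TriState) × Bool

/-- The joins between `a`, `b`, `b'`, `c` and `c'` made by a hyperedge:
`ab, ab', ac, ac', bc, bc', b'c, b'c'`. -/
abbrev Joins : Type := (Bool × Bool) × (Bool × Bool) × (Bool × Bool) × (Bool × Bool)

/-- The join from `a` to `b` on level `i`. -/
def Joins.ab (l : Joins) (i : Bool) : Bool := bif i then l.1.2 else l.1.1

/-- The join from `a` to `c` on level `j`. -/
def Joins.ac (l : Joins) (j : Bool) : Bool := bif j then l.2.1.2 else l.2.1.1

/-- The join from `b` on level `i` to `c` on level `j`. -/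
def Joins.bc (l : Joins) (i j : Bool) : Bool :=
  bif i then (bif j then l.2.2.2.2 else l.2.2.2.1) else (bif j then l.2.2.1.2 else l.2.2.1.1)

/-- The joins made by a hyperedge in a given state. -/
def TwistedState.joins : TwistedState → Joins
  | ((s, t), false) => ((s.left, t.left), (s.right, t.right), (s.isNone, false), (false, t.isNone))
  | ((s, t), true) => ((s.left, t.left), (t.right, s.right), (false, s.isNone), (t.isNone, false))

/-- The joins made by the six hyperedges, where both levels of a transversal vertex are
represented by the lower one. -/
inductive JoinRel (l : Fin 6 → Joins) : Fin 10 × Bool → Fin 10 × Bool → Prop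
  | ab (e : Fin 6) (i : Bool) : (l e).ab i = true →
      JoinRel l ((hollomEdge e).1, false) ((hollomEdge e).2.1, i)
  | ac (e : Fin 6) (j : Bool) : (l e).ac j = true →
      JoinRel l ((hollomEdge e).1, false) ((hollomEdge e).2.2, j)
  | bc (e : Fin 6) (i j : Bool) : (l e).bc i j = true →
      JoinRel l ((hollomEdge e).2.1, i) ((hollomEdge e).2.2, j)

theorem eqvGen_map {α β : Type*} {r : α → α → Prop} {r' : β → β → Prop} {φ : α → β}
    (h : ∀ x y, r x y → Relation.EqvGen r' (φ x) (φ y)) {x y : α} (hxy : Relation.EqvGen r x y) :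
    Relation.EqvGen r' (φ x) (φ y) := by
  induction hxy with
  | rel x y hr => exact h x y hr
  | refl x => exact .refl _
  | symm x y _ ih => exact ih.symm _ _
  | trans x y z _ _ ih₁ ih₂ => exact ih₁.trans _ _ _ ih₂

theorem eqvGen_iff_of_invariant {α : Type*} {r : α → α → Prop} {P : α → Prop}
    (h : ∀ x y, r x y → (P x ↔ P y)) {x y : α} (hxy : Relation.EqvGen r x y) : P x ↔ P y := by
  induction hxy with
  | rel x y hr => exact h x y hr
  | refl x => exact Iff.rfl
  | symm x y _ ih => exact ih.symm
  | trans x y z _ _ ih₁ ih₂ => exact ih₁.trans ih₂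

open Classical in
/-- The indicator of `u ↔ v` minus the indicator of `u ↔ v'`. -/
noncomputable def excess (l : Fin 6 → Joins) : ℝ :=
  (if Relation.EqvGen (JoinRel l) (0, false) (9, false) then 1 else 0) -
    if Relation.EqvGen (JoinRel l) (0, false) (9, true) then 1 else 0

theorem abs_excess_le (l : Fin 6 → Joins) : |excess l| ≤ 1 := by
  unfold excess
  split_ifs <;> norm_num

/-! ### Twisting a hyperedge -/

/-- The sign of a twist. -/
def twistSign (θ : Bool) : ℝ := bif θ then -1 else 1

theorem twistSign_xor (x y : Bool) : twistSign (x ^^ y) = twistSign x * twistSign y := by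
  cases x <;> cases y <;> simp [twistSign]

/-- The change of levels at the ten vertices that undoes the twists `θ`. -/
def untwist (θ : Fin 6 → Bool) : Fin 10 → Bool :=
  ![false, false, θ 0, θ 0 ^^ θ 1 ^^ θ 2 ^^ θ 3, θ 0 ^^ θ 1 ^^ θ 2, θ 0 ^^ θ 1, false,
    θ 0 ^^ θ 1 ^^ θ 2 ^^ θ 3 ^^ θ 4, false, θ 0 ^^ θ 1 ^^ θ 2 ^^ θ 3 ^^ θ 4 ^^ θ 5]

theorem untwist_transversal (θ : Fin 6 → Bool) (e : Fin 6) :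
    untwist θ (hollomEdge e).1 = false := by
  fin_cases e <;> rfl

/-- This is where the chain structure enters: the c-end of each hyperedge is the b-end of the next,
so the level changes are the partial parities of the twists. -/
theorem untwist_right (θ : Fin 6 → Bool) (e : Fin 6) :
    untwist θ (hollomEdge e).2.2 = (untwist θ (hollomEdge e).2.1 ^^ θ e) := by
  fin_cases e <;> simp [hollomEdge, untwist]

theorem prod_twistSign (θ : Fin 6 → Bool) : ∏ e, twistSign (θ e) = twistSign (untwist θ 9) := by
  simp [Fin.prod_univ_six, untwist, twistSign_xor, mul_assoc]

/-- The state without a twist obtained by a change of level `x` at `b`. -/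
def TwistedState.relevel (x : Bool) (s : TriState × TriState) : TwistedState :=
  (bif x then s.swap else s, false)

/-- Exchanging the two levels of a hyperedge moves b and c together and leaves a alone, since both
copies of a are one vertex; the twist then moves c once more. -/
theorem joins_relevel (s : TriState × TriState) (x θ : Bool) :
    (∀ i, (TwistedState.relevel x s).joins.ab (i ^^ x) = (TwistedState.joins (s, θ)).ab i) ∧
    (∀ j, (TwistedState.relevel x s).joins.ac (j ^^ (x ^^ θ)) =
      (TwistedState.joins (s, θ)).ac j) ∧
    ∀ i j, (TwistedState.relevel x s).joins.bc (i ^^ x) (j ^^ (x ^^ θ)) =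
      (TwistedState.joins (s, θ)).bc i j := by
  obtain ⟨s, t⟩ := s
  refine ⟨fun i => ?_, fun j => ?_, fun i j => ?_⟩ <;> cases x <;> cases θ <;>
    first
    | rfl
    | (cases i <;> rfl)
    | (cases j <;> rfl)
    | (cases i <;> cases j <;> rfl)

theorem eqvGen_untwist (s : Fin 6 → TriState × TriState) (θ : Fin 6 → Bool) (x y : Fin 10 × Bool) :
    Relation.EqvGen (JoinRel fun e => TwistedState.joins (s e, θ e)) x y ↔
      Relation.EqvGen
        (JoinRel fun e => (TwistedState.relevel (untwist θ (hollomEdge e).2.1) (s e)).joins)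
        (x.1, x.2 ^^ untwist θ x.1) (y.1, y.2 ^^ untwist θ y.1) := by
  have H := fun e => joins_relevel (s e) (untwist θ (hollomEdge e).2.1) (θ e)
  constructor
  · refine eqvGen_map (φ := fun x : Fin 10 × Bool => (x.1, x.2 ^^ untwist θ x.1)) ?_
    rintro x y (⟨e, i, h⟩ | ⟨e, j, h⟩ | ⟨e, i, j, h⟩) <;> refine .rel _ _ ?_
    · have := JoinRel.ab (l := fun e =>
        (TwistedState.relevel (untwist θ (hollomEdge e).2.1) (s e)).joins) e
        (i ^^ untwist θ (hollomEdge e).2.1) (((H e).1 i).trans h)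
      simpa [untwist_transversal] using this
    · have := JoinRel.ac (l := fun e =>
        (TwistedState.relevel (untwist θ (hollomEdge e).2.1) (s e)).joins) e
        (j ^^ (untwist θ (hollomEdge e).2.1 ^^ θ e)) (((H e).2.1 j).trans h)
      simpa [untwist_transversal, untwist_right] using this
    · have := JoinRel.bc (l := fun e =>
        (TwistedState.relevel (untwist θ (hollomEdge e).2.1) (s e)).joins) e
        (i ^^ untwist θ (hollomEdge e).2.1)
        (j ^^ (untwist θ (hollomEdge e).2.1 ^^ θ e)) (((H e).2.2 i j).trans h)
      simpa [untwist_right] using this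
  · intro h
    have := eqvGen_map (φ := fun x : Fin 10 × Bool => (x.1, x.2 ^^ untwist θ x.1))
      (r' := JoinRel fun e => TwistedState.joins (s e, θ e)) ?_ h
    · simpa using this
    rintro x y (⟨e, i, h⟩ | ⟨e, j, h⟩ | ⟨e, i, j, h⟩) <;> refine .rel _ _ ?_
    · have := JoinRel.ab (l := fun e => TwistedState.joins (s e, θ e)) e
        (i ^^ untwist θ (hollomEdge e).2.1) (by rw [← (H e).1]; simpa using h)
      simpa [untwist_transversal] using this
    · have := JoinRel.ac (l := fun e => TwistedState.joins (s e, θ e)) e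
        (j ^^ (untwist θ (hollomEdge e).2.1 ^^ θ e)) (by rw [← (H e).2.1]; simpa using h)
      simpa [untwist_transversal, untwist_right] using this
    · have := JoinRel.bc (l := fun e => TwistedState.joins (s e, θ e)) e
        (i ^^ untwist θ (hollomEdge e).2.1)
        (j ^^ (untwist θ (hollomEdge e).2.1 ^^ θ e)) (by rw [← (H e).2.2]; simpa using h)
      simpa [untwist_right] using this

/-- The level change fixes u_1 and moves u_10 by the total parity of the twists, so an odd number of
twists exchanges v and v'. -/
theorem excess_untwist (s : Fin 6 → TriState × TriState) (θ : Fin 6 → Bool) :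
    excess (fun e => TwistedState.joins (s e, θ e)) = twistSign (untwist θ 9) *
      excess fun e => (TwistedState.relevel (untwist θ (hollomEdge e).2.1) (s e)).joins := by
  have h : ∀ j, _ := fun j => eqvGen_untwist s θ (0, false) (9, j)
  have h0 : untwist θ 0 = false := rfl
  simp only [h0, Bool.xor_false] at h
  have h₁ := propext (h false)
  have h₂ := propext (h true)
  unfold excess
  rw [h₁, h₂]
  cases untwist θ 9
  · exact (one_mul _).symm
  · simp only [twistSign, cond_true, neg_one_mul, neg_sub]
    rfl

/-- The mean of `excess` over independent states with weights `μ`. -/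
noncomputable def meanExcess (μ : TriState → ℝ) : ℝ :=
  ∑ s : Fin 6 → TriState × TriState, (∏ e, μ (s e).1 * μ (s e).2) *
    excess fun e => TwistedState.joins (s e, false)

theorem sum_excess_twist (μ : TriState → ℝ) (θ : Fin 6 → Bool) :
    ∑ s : Fin 6 → TriState × TriState, (∏ e, μ (s e).1 * μ (s e).2) *
      excess (fun e => TwistedState.joins (s e, θ e)) =
    twistSign (untwist θ 9) * meanExcess μ := by
  -- Relevelling only swaps the two independent, identically distributed states of a hyperedge, so
  -- it preserves the product weight.
  let E : (Fin 6 → TriState × TriState) ≃ (Fin 6 → TriState × TriState) :=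
    Equiv.piCongrRight fun e =>
      bif untwist θ (hollomEdge e).2.1 then Equiv.prodComm _ _ else Equiv.refl _
  have hE : ∀ s e, (E s e, false) = TwistedState.relevel (untwist θ (hollomEdge e).2.1) (s e) := by
    intro s e
    simp only [E, Equiv.piCongrRight_apply, Pi.map_apply, TwistedState.relevel]
    cases untwist θ (hollomEdge e).2.1 <;> rfl
  rw [meanExcess, Finset.mul_sum]
  refine Fintype.sum_equiv E _ _ fun s => ?_
  rw [excess_untwist]
  simp only [hE]
  rw [mul_left_comm]
  congr 2
  refine Finset.prod_congr rfl fun e _ => ?_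
  simp only [E, Equiv.piCongrRight_apply, Pi.map_apply]
  cases untwist θ (hollomEdge e).2.1 <;> simp [mul_comm]

/-- The signed weight of a twisted state. -/
noncomputable def twistWeight (μ : TriState → ℝ) (q : TwistedState) : ℝ :=
  twistSign q.2 * (μ q.1.1 * μ q.1.2)

/-- The product of the twist signs equals the sign by which the twists change the excess, so each of
the 64 choices of twists contributes the same amount. -/
theorem sum_twistWeight_excess (μ : TriState → ℝ) :
    ∑ q : Fin 6 → TwistedState, (∏ e, twistWeight μ (q e)) * excess (fun e => (q e).joins) =
      64 * meanExcess μ := by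
  rw [← (Equiv.arrowProdEquivProdArrow (Fin 6) (fun _ => TriState × TriState)
    (fun _ => Bool)).symm.sum_comp, Fintype.sum_prod_type_right]
  calc _ = ∑ θ : Fin 6 → Bool, twistSign (untwist θ 9) * (twistSign (untwist θ 9) *
        meanExcess μ) := by
        refine Finset.sum_congr rfl fun θ _ => ?_
        rw [← sum_excess_twist, Finset.mul_sum]
        refine Finset.sum_congr rfl fun s _ => ?_
        simp only [Equiv.arrowProdEquivProdArrow, Equiv.coe_fn_symm_mk, twistWeight,
          Finset.prod_mul_distrib, ← prod_twistSign]
        ring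
    _ = ∑ θ : Fin 6 → Bool, meanExcess μ := by
        refine Finset.sum_congr rfl fun θ _ => ?_
        cases untwist θ 9 <;> simp [twistSign]
    _ = _ := by simp

/-! ### Cancellation -/

/-- The part of the reduced weight on the states in which one level joins all of `a, b, c` and the
other level joins nothing. -/
noncomputable def mainWeight (δ : ℝ) : TwistedState → ℝ
  | ((some (true, true), some (false, false)), θ) => twistSign θ * δ
  | ((some (false, false), some (true, true)), θ) => twistSign θ * δ
  | _ => 0

/-- The part of the reduced weight on the states with a level in which only `b` and `c` are
joined. -/
noncomputable def errorWeight (μ : TriState → ℝ) : TwistedState → ℝ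
  | ((some _, some _), _) => 0
  | q => twistWeight μ q

/-- The correlation `P(abc) P(a|b|c) - P(ab|c) P(ac|b)`. -/
noncomputable def correlation (μ : TriState → ℝ) : ℝ :=
  μ (some (true, true)) * μ (some (false, false)) - μ (some (true, false)) * μ (some (false, true))

/-- Write a state as joins x, x' from a to b and y, y' from a to c on the two levels. The same joins
arise with a twist from the states (x, y') and (x', y), so their total weight is μ(x,y)μ(x',y') -
μ(x,y')μ(x',y). It vanishes if x = x' or y = y' and is ±δ otherwise. -/
theorem sum_twistWeight_mul (μ : TriState → ℝ) (g : Joins → ℝ) :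
    ∑ q, twistWeight μ q * g q.joins =
      ∑ q, (mainWeight (correlation μ) q + errorWeight μ q) * g q.joins := by
  simp only [Fintype.sum_prod_type, Fintype.sum_option, Fintype.sum_bool, twistWeight, mainWeight,
    errorWeight, twistSign, TwistedState.joins, TriState.left, TriState.right, cond_true,
    cond_false, Option.isNone, correlation]
  ring

/-! ### The main term -/

/-- The joins of `a` to `b` on level `x.1` and to `c` on level `x.2`. -/
def mainJoins (x : Bool × Bool) : Joins :=
  ((!x.1, x.1), (!x.2, x.2), (false, false), (false, false))

theorem mainJoins_ab {x : Bool × Bool} {i : Bool} : (mainJoins x).ab i = true ↔ i = x.1 := by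
  obtain ⟨y, z⟩ := x
  cases i <;> cases y <;> simp [mainJoins, Joins.ab]

theorem mainJoins_ac {x : Bool × Bool} {j : Bool} : (mainJoins x).ac j = true ↔ j = x.2 := by
  obtain ⟨y, z⟩ := x
  cases j <;> cases z <;> simp [mainJoins, Joins.ac]

theorem mainJoins_bc {x : Bool × Bool} {i j : Bool} : (mainJoins x).bc i j = false := by
  cases i <;> cases j <;> rfl

theorem sum_mainWeight_mul (δ : ℝ) (g : Joins → ℝ) :
    ∑ q, mainWeight δ q * g q.joins =
      ∑ x : Bool × Bool, twistSign (x.1 ^^ x.2) * δ * g (mainJoins x) := by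
  simp only [Fintype.sum_prod_type, Fintype.sum_option, Fintype.sum_bool, mainWeight, twistSign,
    TwistedState.joins, TriState.left, TriState.right, cond_true, cond_false, Option.isNone,
    mainJoins, Bool.xor_true, Bool.xor_false, Bool.not_true, Bool.not_false]
  ring

/-- Whether the consecutive hyperedges `e` and `e'` meet on the same level. -/
def meets (x : Fin 6 → Bool × Bool) (e e' : Fin 6) : Bool := (x e).2 == (x e').1

/-- Whether `u_2` and `u_9` are joined. -/
def endsJoined (x : Fin 6 → Bool × Bool) : Bool :=
  meets x 0 1 || ((meets x 2 3 || meets x 3 4) && (meets x 1 2 || meets x 4 5))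

/-- Whether `u_2` and `u_7` are joined. -/
def middleJoined (x : Fin 6 → Bool × Bool) : Bool :=
  meets x 2 3 || meets x 3 4 || (meets x 0 1 && (meets x 1 2 || meets x 4 5))

/-- The component of `u_2`. -/
def mainComponent (x : Fin 6 → Bool × Bool) : Fin 10 × Bool → Bool
  | (v, i) =>
    let A := true
    let B := middleJoined x
    let C := endsJoined x
    (![(i == (x 0).1) && A, A, (i == (x 0).2) && A || (i == (x 1).1) && C,
      (i == (x 3).2) && A || (i == (x 4).1) && B, (i == (x 2).2) && B || (i == (x 3).1) && A,
      (i == (x 1).2) && C || (i == (x 2).1) && B, B,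
      (i == (x 4).2) && B || (i == (x 5).1) && C, C, (i == (x 5).2) && C] : Fin 10 → Bool) v

theorem mainComponent_invariant (x : Fin 6 → Bool × Bool) (y z : Fin 10 × Bool)
    (h : JoinRel (fun e => mainJoins (x e)) y z) :
    mainComponent x y = true ↔ mainComponent x z = true := by
  rcases h with ⟨e, i, h⟩ | ⟨e, j, h⟩ | ⟨e, i, j, h⟩
  · obtain rfl := mainJoins_ab.1 h
    fin_cases e <;>
      simp [mainComponent, hollomEdge, endsJoined, middleJoined, meets] <;> grind
  · obtain rfl := mainJoins_ac.1 h
    fin_cases e <;>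
      simp [mainComponent, hollomEdge, endsJoined, middleJoined, meets] <;> grind
  · simp [mainJoins_bc] at h

theorem eqvGen_meets {x : Fin 6 → Bool × Bool} {e e' : Fin 6}
    (he : (hollomEdge e).2.2 = (hollomEdge e').2.1) (h : meets x e e' = true) :
    Relation.EqvGen (JoinRel fun e => mainJoins (x e))
      ((hollomEdge e).1, false) ((hollomEdge e').1, false) := by
  have h₁ := JoinRel.ac (l := fun e => mainJoins (x e)) e _ (mainJoins_ac.2 rfl)
  have h₂ := JoinRel.ab (l := fun e => mainJoins (x e)) e' _ (mainJoins_ab.2 rfl)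
  simp only [meets, beq_iff_eq] at h
  rw [he, h] at h₁
  exact (Relation.EqvGen.rel _ _ h₁).trans _ _ _ ((Relation.EqvGen.rel _ _ h₂).symm _ _)

theorem eqvGen_of_endsJoined {x : Fin 6 → Bool × Bool} (h : endsJoined x = true) :
    Relation.EqvGen (JoinRel fun e => mainJoins (x e)) (1, false) (8, false) := by
  have h01 := eqvGen_meets (x := x) (e := 0) (e' := 1) rfl
  have h12 := eqvGen_meets (x := x) (e := 1) (e' := 2) rfl
  have h23 := eqvGen_meets (x := x) (e := 2) (e' := 3) rfl
  have h34 := eqvGen_meets (x := x) (e := 3) (e' := 4) rfl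
  have h45 := eqvGen_meets (x := x) (e := 4) (e' := 5) rfl
  simp only [endsJoined, Bool.or_eq_true, Bool.and_eq_true] at h
  rcases h with h | ⟨h, h'⟩
  · exact h01 h
  · refine Relation.EqvGen.trans _ (6, false) _ ?_ ?_
    · rcases h with h | h
      · exact (h23 h).symm _ _
      · exact h34 h
    · rcases h' with h | h
      · exact (h12 h).symm _ _
      · exact h45 h

theorem eqvGen_mainJoins (x : Fin 6 → Bool × Bool) (j : Bool) :
    Relation.EqvGen (JoinRel fun e => mainJoins (x e)) (0, false) (9, j) ↔
      (x 0).1 = false ∧ (x 5).2 = j ∧ endsJoined x = true := by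
  have h₀ := JoinRel.ab (l := fun e => mainJoins (x e)) 0 _ (mainJoins_ab.2 rfl)
  have h₅ := JoinRel.ac (l := fun e => mainJoins (x e)) 5 _ (mainJoins_ac.2 rfl)
  constructor
  · intro h
    have h1 : (x 0).1 = false := by
      -- The only join that can touch u_1 leads to its copy on level `(x 0).1`; if that is the upper
      -- level, the lower copy is isolated.
      by_contra h1
      have := eqvGen_iff_of_invariant (P := fun y => y = (0, false)) ?_ h
      · simp at this
      rintro y z (⟨e, i, h⟩ | ⟨e, j, h⟩ | ⟨e, i, j, h⟩)
      · obtain rfl := mainJoins_ab.1 h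
        fin_cases e <;> simp [hollomEdge, h1]
      · fin_cases e <;> simp [hollomEdge]
      · simp [mainJoins_bc] at h
    have := eqvGen_iff_of_invariant (mainComponent_invariant x) h
    simp [mainComponent, h1] at this
    exact ⟨h1, this.1.symm, this.2⟩
  · rintro ⟨h, rfl, h'⟩
    rw [h] at h₀
    exact ((Relation.EqvGen.rel _ _ h₀).symm _ _).trans _ _ _
      ((eqvGen_of_endsJoined h').trans _ _ _ (.rel _ _ h₅))

theorem excess_mainJoins (x : Fin 6 → Bool × Bool) :
    excess (fun e => mainJoins (x e)) =
      if !(x 0).1 && endsJoined x then twistSign (x 5).2 else 0 := by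
  have h₁ := propext (eqvGen_mainJoins x false)
  have h₂ := propext (eqvGen_mainJoins x true)
  unfold excess
  rw [h₁, h₂]
  cases (x 0).1 <;> cases (x 5).2 <;> cases endsJoined x <;> simp [twistSign]

/-- The sign of a twist as an integer. -/
def twistSignInt (θ : Bool) : ℤ := bif θ then -1 else 1

theorem twistSign_eq_cast (θ : Bool) : twistSign θ = twistSignInt θ := by
  cases θ <;> simp [twistSign, twistSignInt]

theorem sum_fin_succ {α M : Type*} [Fintype α] [AddCommMonoid M] {n : ℕ}
    (F : (Fin (n + 1) → α) → M) :
    ∑ x, F x = ∑ a, ∑ y : Fin n → α, F (Fin.cons a y) := by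
  rw [← (Fin.consEquiv fun _ => α).sum_comp, Fintype.sum_prod_type]
  rfl

/-- Regroup the signs along the chain: `(x 0).1` is false, the two signs of `(x 5).2` cancel, and
every other factor is 1 or -1 according to whether two consecutive hyperedges meet. Each pattern of
the five meetings arises from 64 choices of levels. If hyperedges 0 and 1 meet, the signs sum to 0.
Otherwise there is a factor -1 times the square of the signed count of pairs with at least one
meeting, which is 1 - 1 - 1 = -1. The total is -64. -/
theorem sum_signs_int :
    ∑ x : Fin 6 → Bool × Bool, (∏ e, twistSignInt ((x e).1 ^^ (x e).2)) *
      (bif !(x 0).1 && endsJoined x then twistSignInt (x 5).2 else 0) = -64 := by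
  simp only [sum_fin_succ]
  decide +kernel

theorem sum_mainWeight (δ : ℝ) :
    ∑ q : Fin 6 → TwistedState, (∏ e, mainWeight δ (q e)) * excess (fun e => (q e).joins) =
      -64 * δ ^ 6 := by
  rw [sum_pi_prod_congr (sum_mainWeight_mul δ)]
  have h := congrArg (Int.cast : ℤ → ℝ) sum_signs_int
  push_cast at h
  rw [← h, Finset.sum_mul]
  refine Finset.sum_congr rfl fun x _ => ?_
  rw [excess_mainJoins, Finset.prod_mul_distrib]
  cases !(x 0).1 && endsJoined x <;> simp [twistSign_eq_cast, mul_right_comm]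

/-! ### The error term -/

theorem mainWeight_mul_errorWeight (δ : ℝ) (μ : TriState → ℝ) (q : TwistedState) :
    mainWeight δ q = 0 ∨ errorWeight μ q = 0 := by
  obtain ⟨⟨_ | s, _ | t⟩, θ⟩ := q
  · exact .inl rfl
  · exact .inl (by simp [mainWeight])
  · exact .inl (by simp [mainWeight])
  · exact .inr rfl

theorem sum_abs_mainWeight {δ : ℝ} (hδ : 0 ≤ δ) : ∑ q, |mainWeight δ q| = 4 * δ := by
  simp only [Fintype.sum_prod_type, Fintype.sum_option, Fintype.sum_bool, mainWeight, twistSign,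
    cond_true, cond_false, abs_zero, one_mul, neg_mul, abs_neg, abs_of_nonneg hδ]
  ring

/-- The total is twice the probability 1 - (1 - κ)^2 that some level is in the state `none`; the
factor 2 counts the twists. -/
theorem sum_abs_errorWeight {μ : TriState → ℝ} (hμ : ∀ s, 0 ≤ μ s) (h : ∑ s, μ s = 1) :
    ∑ q, |errorWeight μ q| ≤ 4 * μ none := by
  have h0 := hμ none
  have : ∑ q, |errorWeight μ q| = 4 * μ none * ∑ s, μ s - 2 * μ none ^ 2 := by
    simp only [Fintype.sum_prod_type, Fintype.sum_option, Fintype.sum_bool, errorWeight,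
      twistWeight, twistSign, cond_true, cond_false, abs_zero, one_mul, neg_mul, abs_neg, abs_mul,
      abs_of_nonneg (hμ _)]
    ring
  rw [this, h]
  nlinarith

/-- Expand the product over coordinates: the terms that use `w` everywhere cancel, and the others
are bounded by the corresponding terms of the power of the total absolute weight. -/
theorem abs_sum_prod_add_sub_le {ι Q : Type*} [Fintype ι] [DecidableEq ι] [Fintype Q]
    {w w' : Q → ℝ} (h : ∀ q, w q = 0 ∨ w' q = 0) {F : (ι → Q) → ℝ} (hF : ∀ q, |F q| ≤ 1) :
    |∑ q : ι → Q, (∏ i, (w (q i) + w' (q i))) * F q - ∑ q : ι → Q, (∏ i, w (q i)) * F q| ≤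
      (∑ q, |w q| + ∑ q, |w' q|) ^ Fintype.card ι - (∑ q, |w q|) ^ Fintype.card ι := by
  have hpow : ∀ v : Q → ℝ, (∑ q, v q) ^ Fintype.card ι = ∑ q : ι → Q, ∏ i, v (q i) := by
    intro v
    rw [← Finset.card_univ, ← Finset.prod_const, Finset.prod_univ_sum, Fintype.piFinset_univ]
  rw [← Finset.sum_add_distrib, hpow, hpow, ← Finset.sum_sub_distrib, ← Finset.sum_sub_distrib]
  refine (Finset.abs_sum_le_sum_abs _ _).trans (Finset.sum_le_sum fun q _ => ?_)
  rw [← sub_mul, abs_mul]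
  refine (mul_le_of_le_one_right (abs_nonneg _) (hF q)).trans ?_
  -- If `w'` vanishes at every coordinate, the two products agree. Otherwise `w` vanishes at some
  -- coordinate by disjointness of supports, and only the first product remains.
  by_cases hq : ∀ i, w' (q i) = 0
  · simp [hq]
  · push Not at hq
    obtain ⟨i, hi⟩ := hq
    have hi' := (h (q i)).resolve_right hi
    rw [Finset.prod_eq_zero (f := fun i => w (q i)) (Finset.mem_univ i) hi',
      Finset.prod_eq_zero (f := fun i => |w (q i)|) (Finset.mem_univ i) (by simp [hi']), sub_zero,
      sub_zero, Finset.abs_prod]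
    exact Finset.prod_le_prod (fun _ _ => abs_nonneg _) fun _ _ => abs_add_le _ _

theorem meanExcess_neg {μ : TriState → ℝ} (hμ : ∀ s, 0 ≤ μ s) (h : ∑ s, μ s = 1)
    (h0 : 0 < μ none) (hδ : 400 * μ none ≤ correlation μ) : meanExcess μ < 0 := by
  set δ := correlation μ
  have hδ0 : 0 < δ := by linarith
  have h1 := abs_sum_prod_add_sub_le (mainWeight_mul_errorWeight δ μ)
    fun q : Fin 6 → TwistedState => abs_excess_le fun e => (q e).joins
  rw [← sum_pi_prod_congr (sum_twistWeight_mul μ), sum_twistWeight_excess, sum_mainWeight,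
    sum_abs_mainWeight hδ0.le, Fintype.card_fin] at h1
  -- The constant 400 is chosen so that 4^6 * ((1 + 1/400)^6 - 1), about 61.8, is less than 64.
  have h2 : (4 * δ + ∑ q, |errorWeight μ q|) ^ 6 ≤ (4 * δ * (1 + 1 / 400)) ^ 6 := by
    have := sum_abs_errorWeight hμ h
    have h3 : 0 ≤ ∑ q, |errorWeight μ q| := Finset.sum_nonneg fun _ _ => abs_nonneg _
    gcongr
    linarith
  have h3 := (abs_le.1 h1).2
  have h4 : 0 < δ ^ 6 := by positivity
  rw [mul_pow] at h2
  rw [mul_pow] at h2 h3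
  norm_num at h2
  nlinarith

/-! ## Percolation on the gadget -/

/-- The retained edges of the gadget: spokes `{a, v_{i+1}}` with `s i` and path edges
`{v_{i+1}, v_{i+2}}` with `p i`. -/
inductive GadgetRel {m : ℕ} (s : Fin (m + 1) → Bool) (p : Fin m → Bool) :
    Option (Fin (m + 1)) → Option (Fin (m + 1)) → Prop
  | spoke (i) : s i = true → GadgetRel s p none (some i)
  | path (i) : p i = true → GadgetRel s p (some i.castSucc) (some i.succ)

section

variable {m : ℕ} {s : Fin (m + 1) → Bool} {p : Fin m → Bool}

/-- Some spoke is joined to `v_1` by the path. -/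
def LeftJoined (s : Fin (m + 1) → Bool) (p : Fin m → Bool) : Prop :=
  ∃ j, s j = true ∧ ∀ i : Fin m, i.val < j.val → p i = true

/-- Some spoke is joined to the last vertex by the path. -/
def RightJoined (s : Fin (m + 1) → Bool) (p : Fin m → Bool) : Prop :=
  ∃ j, s j = true ∧ ∀ i : Fin m, j.val ≤ i.val → p i = true

theorem eqvGen_some_zero {k : Fin (m + 1)} (h : ∀ i : Fin m, i.val < k.val → p i = true) :
    Relation.EqvGen (GadgetRel s p) (some 0) (some k) := by
  induction k using Fin.induction with
  | zero => exact .refl _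
  | succ k ih =>
    exact (ih fun i hi => h i (by simp at hi ⊢; omega)).trans _ _ _
      (.rel _ _ (.path k (h k (by simp))))

theorem eqvGen_some_last {k : Fin (m + 1)} (h : ∀ i : Fin m, k.val ≤ i.val → p i = true) :
    Relation.EqvGen (GadgetRel s p) (some k) (some (Fin.last m)) := by
  induction k using Fin.reverseInduction with
  | last => exact .refl _
  | cast k ih =>
    exact (Relation.EqvGen.rel _ _ (.path k (h k (by simp)))).trans _ _ _
      (ih fun i hi => h i (by simp at hi ⊢; omega))

/-- The vertices reached from v_1 along retained path edges form an initial segment. If no retained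
spoke ends there, no retained edge leaves it. -/
theorem prefix_invariant (h : ¬ LeftJoined s p) (x y : Option (Fin (m + 1)))
    (hxy : GadgetRel s p x y) :
    (∃ k, x = some k ∧ ∀ i : Fin m, i.val < k.val → p i = true) ↔
      ∃ k, y = some k ∧ ∀ i : Fin m, i.val < k.val → p i = true := by
  rcases hxy with ⟨i, hi⟩ | ⟨i, hi⟩
  · simp only [reduceCtorEq, false_and, exists_false, Option.some.injEq, exists_eq_left',
      false_iff]
    exact fun h' => h ⟨i, hi, h'⟩
  · simp only [Option.some.injEq, exists_eq_left', Fin.val_castSucc, Fin.val_succ]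
    refine ⟨fun h j hj => ?_, fun h j hj => h j (by omega)⟩
    rcases Nat.lt_succ_iff_lt_or_eq.1 hj with hj | hj
    · exact h j hj
    · rwa [Fin.ext hj]

theorem suffix_invariant (h : ¬ RightJoined s p) (x y : Option (Fin (m + 1)))
    (hxy : GadgetRel s p x y) :
    (∃ k, x = some k ∧ ∀ i : Fin m, k.val ≤ i.val → p i = true) ↔
      ∃ k, y = some k ∧ ∀ i : Fin m, k.val ≤ i.val → p i = true := by
  rcases hxy with ⟨i, hi⟩ | ⟨i, hi⟩
  · simp only [reduceCtorEq, false_and, exists_false, Option.some.injEq, exists_eq_left',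
      false_iff]
    exact fun h' => h ⟨i, hi, h'⟩
  · simp only [Option.some.injEq, exists_eq_left', Fin.val_castSucc, Fin.val_succ]
    refine ⟨fun h j hj => h j (by omega), fun h j hj => ?_⟩
    rcases Nat.lt_or_eq_of_le hj with hj | hj
    · exact h j hj
    · rwa [← Fin.ext hj]

theorem eqvGen_none_zero :
    Relation.EqvGen (GadgetRel s p) none (some 0) ↔ LeftJoined s p := by
  constructor
  · intro h
    by_contra h'
    simpa using eqvGen_iff_of_invariant (prefix_invariant h') h
  · rintro ⟨j, hj, h⟩
    exact (Relation.EqvGen.rel _ _ (.spoke j hj)).trans _ _ _ ((eqvGen_some_zero h).symm _ _)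

theorem eqvGen_none_last :
    Relation.EqvGen (GadgetRel s p) none (some (Fin.last m)) ↔ RightJoined s p := by
  constructor
  · intro h
    by_contra h'
    have := eqvGen_iff_of_invariant (suffix_invariant h') h
    simp only [reduceCtorEq, false_and, exists_false, Option.some.injEq, exists_eq_left',
      Fin.val_last, false_iff] at this
    exact this fun i hi => absurd i.isLt (by omega)
  · rintro ⟨j, hj, h⟩
    exact (Relation.EqvGen.rel _ _ (.spoke j hj)).trans _ _ _ (eqvGen_some_last h)

open Classical in
/-- The partition of the three terminals of the gadget. -/
noncomputable def triState (s : Fin (m + 1) → Bool) (p : Fin m → Bool) : TriState :=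
  if (∀ i, p i = true) ∧ ∀ j, s j = false then none
  else some (decide (LeftJoined s p), decide (RightJoined s p))

theorem triState_eq_none : triState s p = none ↔ (∀ i, p i = true) ∧ ∀ j, s j = false := by
  unfold triState
  split_ifs with h <;> simp [h]

theorem triState_eq_some {l r : Bool} : triState s p = some (l, r) ↔
    ¬ ((∀ i, p i = true) ∧ ∀ j, s j = false) ∧ (LeftJoined s p ↔ l = true) ∧
      (RightJoined s p ↔ r = true) := by
  unfold triState
  split_ifs with h
  · simp [h]
  · simp only [Option.some.injEq, Prod.mk.injEq, h, not_false_eq_true, true_and]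
    cases l <;> cases r <;> simp

theorem triState_left : (triState s p).left = true ↔ LeftJoined s p := by
  unfold triState
  split_ifs with h
  · simp [TriState.left, LeftJoined, h.2]
  · simp [TriState.left]

theorem triState_right : (triState s p).right = true ↔ RightJoined s p := by
  unfold triState
  split_ifs with h
  · simp [TriState.right, RightJoined, h.2]
  · simp [TriState.right]

/-- The two ends of the path can be joined without a only when the whole path is retained and there
is no spoke, which is the state `none`. -/
theorem eqvGen_zero_last :
    Relation.EqvGen (GadgetRel s p) (some 0) (some (Fin.last m)) ↔
      (LeftJoined s p ∧ RightJoined s p) ∨ triState s p = none := by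
  constructor
  · intro h
    by_cases hl : LeftJoined s p
    · exact .inl ⟨hl, eqvGen_none_last.1 ((eqvGen_none_zero.2 hl).trans _ _ _ h)⟩
    · right
      have := eqvGen_iff_of_invariant (prefix_invariant hl) h
      simp only [Option.some.injEq, exists_eq_left', Fin.val_last, Fin.val_zero, not_lt_zero,
        false_imp_iff, implies_true, true_iff, Fin.is_lt, true_imp_iff] at this
      refine triState_eq_none.2 ⟨this, fun j => ?_⟩
      by_contra hj
      exact hl ⟨j, by simpa using hj, fun i _ => this i⟩
  · rintro (⟨hl, hr⟩ | h)
    · exact ((eqvGen_none_zero.2 hl).symm _ _).trans _ _ _ (eqvGen_none_last.2 hr)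
    · exact eqvGen_some_zero fun i _ => (triState_eq_none.1 h).1 i

/-! ### The distribution of the state -/

/-- The state after adding a vertex to the path, with path edge `a` and spoke `b`. -/
def TriState.step (a b : Bool) : TriState → TriState
  | none => if a then if b then some (true, true) else none else some (false, b)
  | some (x, y) => some (x, b || (a && y))

theorem leftJoined_snoc {a b : Bool} :
    LeftJoined (Fin.snoc s b : Fin (m + 2) → Bool) (Fin.snoc p a : Fin (m + 1) → Bool) ↔
      LeftJoined s p ∨ (b = true ∧ a = true ∧ ∀ i, p i = true) := by
  unfold LeftJoined
  rw [Fin.exists_fin_succ']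
  simp only [Fin.forall_fin_succ', Fin.snoc_castSucc, Fin.snoc_last, Fin.val_castSucc,
    Fin.val_last]
  have h₁ : ∀ j : Fin (m + 1), ¬ m < j.val := fun j => by omega
  have h₂ : ∀ j : Fin m, j.val < m + 1 := fun j => by omega
  simp only [h₁, h₂, true_imp_iff, m.lt_succ_self]
  simp only [false_imp_iff, and_true, and_comm (b := a = true)]

theorem rightJoined_snoc {a b : Bool} :
    RightJoined (Fin.snoc s b : Fin (m + 2) → Bool) (Fin.snoc p a : Fin (m + 1) → Bool) ↔
      b = true ∨ (a = true ∧ RightJoined s p) := by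
  unfold RightJoined
  rw [Fin.exists_fin_succ']
  simp only [Fin.forall_fin_succ', Fin.snoc_castSucc, Fin.snoc_last, Fin.val_castSucc,
    Fin.val_last]
  have h₁ : ∀ j : Fin (m + 1), j.val ≤ m := fun j => by omega
  have h₂ : ∀ j : Fin m, ¬ m + 1 ≤ j.val := fun j => by omega
  simp only [h₁, h₂, true_imp_iff, false_imp_iff, implies_true,
    show ¬ m + 1 ≤ m by omega, and_true]
  constructor
  · rintro (⟨j, h, h', h''⟩ | h)
    · exact .inr ⟨h'', j, h, h'⟩
    · exact .inl h
  · rintro (h | ⟨h'', j, h, h'⟩)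
    · exact .inr h
    · exact .inl ⟨j, h, h', h''⟩

/-- The state evolves as a Markov chain as the path grows, so its distribution satisfies a linear
recursion. -/
theorem triState_snoc (a b : Bool) :
    triState (Fin.snoc s b : Fin (m + 2) → Bool) (Fin.snoc p a : Fin (m + 1) → Bool) =
      (triState s p).step a b := by
  have hnone : ((∀ i, (Fin.snoc p a : Fin (m + 1) → Bool) i = true) ∧
      ∀ j, (Fin.snoc s b : Fin (m + 2) → Bool) j = false) ↔
      ((∀ i, p i = true) ∧ a = true) ∧ (∀ j, s j = false) ∧ b = false := by
    rw [Fin.forall_fin_succ', Fin.forall_fin_succ']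
    simp only [Fin.snoc_castSucc, Fin.snoc_last]
  rcases h : triState s p with _ | ⟨x, y⟩
  · obtain ⟨hp, hs⟩ := triState_eq_none.1 h
    have hl : ¬ LeftJoined s p := by simp [LeftJoined, hs]
    have hr : ¬ RightJoined s p := by simp [RightJoined, hs]
    cases a <;> cases b <;>
      simp [TriState.step, triState_eq_some, triState_eq_none, leftJoined_snoc, rightJoined_snoc,
        hnone, hl, hr, -not_and] <;> simp [hp, hs]
  · obtain ⟨h, hl, hr⟩ := triState_eq_some.1 h
    -- In a state other than `none`, a fully retained path already carries a spoke, so the new spoke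
    -- cannot change whether v_1 is joined to a.
    have hl' : (∀ i, p i = true) → LeftJoined s p := by
      intro hp
      by_contra hl
      refine h ⟨hp, fun j => ?_⟩
      by_contra hj
      exact hl ⟨j, by simpa using hj, fun i _ => hp i⟩
    rw [TriState.step, triState_eq_some, leftJoined_snoc, rightJoined_snoc, hnone]
    refine ⟨fun h' => h ⟨h'.1.1, h'.2.1⟩, ?_, by simp [hr]⟩
    rw [← hl]
    exact ⟨fun h => h.elim id fun h => hl' h.2.2, .inl⟩

end

/-- The probability of a state of the gadget with `m + 1` path vertices at `p = 1 / 2`. -/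
noncomputable def triDist (m : ℕ) (x : TriState) : ℝ :=
  (∑ s : Fin (m + 1) → Bool, ∑ p : Fin m → Bool, if triState s p = x then 1 else 0) /
    2 ^ (2 * m + 1)

theorem triDist_nonneg (m : ℕ) (x : TriState) : 0 ≤ triDist m x := by
  unfold triDist
  positivity

theorem sum_triDist_mul (m : ℕ) (g : TriState → ℝ) :
    ∑ x, triDist m x * g x =
      (∑ s : Fin (m + 1) → Bool, ∑ p : Fin m → Bool, g (triState s p)) / 2 ^ (2 * m + 1) := by
  simp only [triDist, div_mul_eq_mul_div, ← Finset.sum_div, Finset.sum_mul]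
  congr 1
  rw [Finset.sum_comm]
  refine Finset.sum_congr rfl fun s _ => ?_
  rw [Finset.sum_comm]
  refine Finset.sum_congr rfl fun p _ => ?_
  simp

theorem sum_triDist (m : ℕ) : ∑ x, triDist m x = 1 := by
  have := sum_triDist_mul m fun _ => (1 : ℝ)
  simp only [mul_one] at this
  rw [this, div_eq_one_iff_eq (by positivity)]
  simp
  ring

theorem sum_fin_snoc {α M : Type*} [Fintype α] [AddCommMonoid M] {n : ℕ}
    (F : (Fin (n + 1) → α) → M) :
    ∑ x, F x = ∑ a, ∑ y : Fin n → α, F (Fin.snoc y a) := by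
  rw [← (Fin.snocEquiv fun _ => α).sum_comp, Fintype.sum_prod_type]
  rfl

theorem triDist_succ (m : ℕ) (x : TriState) :
    triDist (m + 1) x =
      (∑ b : Bool, ∑ a : Bool, ∑ y, triDist m y * if y.step a b = x then 1 else 0) / 4 := by
  simp only [sum_triDist_mul, ← Finset.sum_div]
  rw [triDist, sum_fin_snoc (n := m + 1), div_div]
  congr 1
  · refine Finset.sum_congr rfl fun b _ => ?_
    conv_rhs => rw [Finset.sum_comm]
    refine Finset.sum_congr rfl fun s _ => ?_
    rw [sum_fin_snoc]
    refine Finset.sum_congr rfl fun a _ => ?_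
    simp only [triState_snoc]
  · ring

theorem triDist_succ_eq (m : ℕ) :
    triDist (m + 1) none = triDist m none / 4 ∧
    triDist (m + 1) (some (true, true)) = (3 * triDist m (some (true, true)) +
      2 * triDist m (some (true, false)) + triDist m none) / 4 ∧
    triDist (m + 1) (some (true, false)) =
      (triDist m (some (true, true)) + 2 * triDist m (some (true, false))) / 4 ∧
    triDist (m + 1) (some (false, true)) = (3 * triDist m (some (false, true)) +
      2 * triDist m (some (false, false)) + triDist m none) / 4 ∧
    triDist (m + 1) (some (false, false)) = (triDist m (some (false, true)) +
      2 * triDist m (some (false, false)) + triDist m none) / 4 := by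
  simp only [triDist_succ, Fintype.sum_option, Fintype.sum_prod_type, Fintype.sum_bool,
    TriState.step]
  refine ⟨?_, ?_, ?_, ?_, ?_⟩ <;> · simp; try ring

theorem triDist_zero :
    triDist 0 none = 1 / 2 ∧ triDist 0 (some (true, true)) = 1 / 2 ∧
    triDist 0 (some (true, false)) = 0 ∧ triDist 0 (some (false, true)) = 0 ∧
    triDist 0 (some (false, false)) = 0 := by
  have h : ∀ (s : Fin 1 → Bool) (p : Fin 0 → Bool),
      triState s p = if s 0 then some (true, true) else none := by
    intro s p
    cases hs : s 0 <;> simp [triState, LeftJoined, RightJoined, hs]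
  simp only [triDist, sum_fin_snoc, h, Fintype.sum_bool]
  simp [Fin.snoc]

/-- The second quantity is conserved by the recursion, and 2/9 is the fixed point of the upper
bounds for P(ab|c) and P(ac|b). The last inequality is an equality for m = 0. -/
theorem triDist_bounds (m : ℕ) :
    0 < triDist m none ∧
    triDist m (some (true, true)) + triDist m (some (true, false)) + triDist m none / 3 = 2 / 3 ∧
    triDist m (some (true, false)) ≤ 2 / 9 ∧ triDist m (some (false, true)) ≤ 2 / 9 ∧
    (m / 3 - 1 / 6 + triDist m none / 3) * triDist m none ≤ correlation (triDist m) := by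
  have hsum := sum_triDist m
  simp only [Fintype.sum_option, Fintype.sum_prod_type, Fintype.sum_bool] at hsum
  induction m with
  | zero =>
    obtain ⟨h1, h2, h3, h4, h5⟩ := triDist_zero
    rw [correlation, h1, h2, h3, h4, h5]
    norm_num
  | succ m ih =>
    have hsum' := sum_triDist m
    simp only [Fintype.sum_option, Fintype.sum_prod_type, Fintype.sum_bool] at hsum'
    obtain ⟨i1, i2, i3, i4, i5⟩ := ih hsum'
    obtain ⟨h1, h2, h3, h4, h5⟩ := triDist_succ_eq m
    rw [correlation] at i5 ⊢
    rw [h1, h2, h3, h4, h5]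
    generalize triDist m none = K at *
    generalize triDist m (some (true, true)) = J at *
    generalize triDist m (some (true, false)) = B at *
    generalize triDist m (some (false, true)) = C at *
    generalize triDist m (some (false, false)) = O at *
    refine ⟨by linarith, by linarith, by linarith, by linarith, ?_⟩
    -- The linear relations give 2J + C + 2O + K = 2 - K - 2B - C, and B and C are at most 2/9. The
    -- new correlation is (JO - BC)/4 + K(2J + C + 2O + K)/16.
    have h6 : 0 ≤ K * (2 * J + C + 2 * O + K - (4 / 3 - K)) := by
      apply mul_nonneg i1.le
      linarith
    push_cast
    nlinarith

/-! ## The structure of the graph -/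

section

variable {m : ℕ}

theorem place_none (e : Fin 6) : place (m + 1) e none = Sum.inl (hollomEdge e).1 := rfl

theorem place_zero (e : Fin 6) : place (m + 1) e (some 0) = Sum.inl (hollomEdge e).2.1 := rfl

theorem place_last (hm : 1 ≤ m) (e : Fin 6) :
    place (m + 1) e (some (Fin.last m)) = Sum.inl (hollomEdge e).2.2 := by
  simp [place, show m ≠ 0 by omega]

theorem place_interior (e : Fin 6) (k : Fin (m + 1 - 2)) :
    place (m + 1) e (some ⟨k.val + 1, by omega⟩) = Sum.inr (e, k) := by
  simp [place, show ¬ k.val + 1 = m by omega]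

theorem exists_place (hm : 1 ≤ m) (v : HollomVertex (m + 1)) : ∃ e x, place (m + 1) e x = v := by
  rcases v with u | ⟨e, k⟩
  · fin_cases u
    · exact ⟨0, some 0, place_zero 0⟩
    · exact ⟨0, none, place_none 0⟩
    · exact ⟨1, some 0, place_zero 1⟩
    · exact ⟨4, some 0, place_zero 4⟩
    · exact ⟨3, some 0, place_zero 3⟩
    · exact ⟨2, some 0, place_zero 2⟩
    · exact ⟨2, none, place_none 2⟩
    · exact ⟨5, some 0, place_zero 5⟩
    · exact ⟨1, none, place_none 1⟩
    · exact ⟨5, some (Fin.last m), place_last hm 5⟩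
  · exact ⟨e, _, place_interior e k⟩

/-- A numbering of the vertices: the six paths form one long path whose vertices are numbered
`0, …, 6 m`, and the transversal vertices have negative numbers. -/
def vertexNum (m : ℕ) : HollomVertex (m + 1) → ℤ
  | .inl u => (![0, -1, m, 4 * m, 3 * m, 2 * m, -2, 5 * m, -3, 6 * m] : Fin 10 → ℤ) u
  | .inr (e, k) => e.val * m + (k.val + 1)

/-- The number of the transversal vertex of a hyperedge. -/
def hubNum : Fin 6 → ℤ := ![-1, -3, -2, -1, -2, -3]

theorem vertexNum_place_none (e : Fin 6) : vertexNum m (place (m + 1) e none) = hubNum e := by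
  fin_cases e <;> rfl

theorem hubNum_neg (e : Fin 6) : hubNum e < 0 := by
  fin_cases e <;> decide

theorem vertexNum_place_some (e : Fin 6) (i : Fin (m + 1)) :
    vertexNum m (place (m + 1) e (some i)) = e.val * m + i.val := by
  by_cases h₁ : i.val = 0
  · obtain rfl : i = 0 := Fin.ext h₁
    rw [place_zero]
    fin_cases e <;> simp [vertexNum, hollomEdge]
  by_cases h₂ : i.val = m
  · obtain rfl : i = Fin.last m := Fin.ext h₂
    rw [place_last (by omega)]
    fin_cases e <;> simp [vertexNum, hollomEdge] <;> ring
  · rw [show i = ⟨(⟨i.val - 1, by omega⟩ : Fin (m + 1 - 2)).val + 1, by simp; omega⟩ from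
      Fin.ext (by simp; omega), place_interior]
    simp [vertexNum]

theorem path_index_unique {e e' : Fin 6} {i i' : ℕ} (hi : i < m) (hi' : i' < m)
    (h : (e.val * m + i : ℤ) = e'.val * m + i') : e = e' ∧ i = i' := by
  have h' : e.val * m + i = e'.val * m + i' := by exact_mod_cast h
  have hd := congrArg (· / m) h'
  have hr := congrArg (· % m) h'
  have hm : 0 < m := by omega
  simp only [Nat.mul_add_mod_self_right, Nat.mod_eq_of_lt hi, Nat.mod_eq_of_lt hi'] at hr
  simp only [Nat.add_comm (_ * m), Nat.add_mul_div_right _ _ hm, Nat.div_eq_of_lt hi,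
    Nat.div_eq_of_lt hi'] at hd
  exact ⟨Fin.ext (by omega), hr⟩

/-- Both ends of a path are allowed here, unlike in `path_index_unique`: consecutive hyperedges
share a path end but never a transversal vertex. -/
theorem spoke_index_unique (hm : 1 ≤ m) {e e' : Fin 6} {i i' : ℕ} (hi : i ≤ m) (hi' : i' ≤ m)
    (hub : hubNum e = hubNum e') (h : (e.val * m + i : ℤ) = e'.val * m + i') :
    e = e' ∧ i = i' := by
  have h' : e.val * m + i = e'.val * m + i' := by exact_mod_cast h
  fin_cases e <;> fin_cases e' <;> simp [hubNum] at hub h' ⊢ <;> omega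

/-- The edges of the six gadgets: spokes and path edges. -/
abbrev EdgeIndex (m : ℕ) : Type := Fin 6 × (Fin (m + 1) ⊕ Fin m)

/-- The first end of an edge. -/
def edgeFst (m : ℕ) : EdgeIndex m → HollomVertex (m + 1)
  | (e, .inl _) => place (m + 1) e none
  | (e, .inr i) => place (m + 1) e (some i.castSucc)

/-- The second end of an edge. -/
def edgeSnd (m : ℕ) : EdgeIndex m → HollomVertex (m + 1)
  | (e, .inl i) => place (m + 1) e (some i)
  | (e, .inr i) => place (m + 1) e (some i.succ)

theorem vertexNum_edgeFst_ne (x : EdgeIndex m) :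
    vertexNum m (edgeFst m x) ≠ vertexNum m (edgeSnd m x) := by
  rcases x with ⟨e, i | i⟩
  · have := hubNum_neg e
    simp only [edgeFst, edgeSnd, vertexNum_place_none, vertexNum_place_some]
    have : (0 : ℤ) ≤ e.val * m + i.val := by positivity
    omega
  · simp [edgeFst, edgeSnd, vertexNum_place_some]

theorem edgeFst_ne (x : EdgeIndex m) : edgeFst m x ≠ edgeSnd m x :=
  fun h => vertexNum_edgeFst_ne x (congrArg _ h)

theorem edge_injective (hm : 1 ≤ m) :
    Function.Injective fun x : EdgeIndex m => s(edgeFst m x, edgeSnd m x) := by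
  intro x y h
  have h := congrArg (Sym2.map (vertexNum m)) h
  simp only [Sym2.map_mk, Sym2.eq_iff] at h
  rcases x with ⟨e, i | i⟩ <;> rcases y with ⟨e', i' | i'⟩ <;>
    simp only [edgeFst, edgeSnd, vertexNum_place_none, vertexNum_place_some, Fin.val_castSucc,
      Fin.val_succ] at h <;>
    have he := hubNum_neg e <;> have he' := hubNum_neg e' <;>
    have hp : (0 : ℤ) ≤ e.val * m + i.val := (by positivity) <;>
    have hp' : (0 : ℤ) ≤ e'.val * m + i'.val := (by positivity)
  · obtain ⟨rfl, h'⟩ := spoke_index_unique hm (by omega) (by omega) (by omega)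
      (show (e.val * m + i.val : ℤ) = e'.val * m + i'.val by omega)
    rw [Fin.ext h']
  · omega
  · omega
  · obtain ⟨rfl, h'⟩ := path_index_unique i.isLt i'.isLt
      (show (e.val * m + i.val : ℤ) = e'.val * m + i'.val by push_cast at h; omega)
    rw [Fin.ext h']

theorem gadget_adj {x y : Option (Fin (m + 1))} : (gadget (m + 1)).Adj x y ↔
    GadgetRel (fun _ => true) (fun _ => true) x y ∨
      GadgetRel (fun _ => true) (fun _ => true) y x := by
  have h : ∀ x y : Option (Fin (m + 1)), GadgetRel (fun _ => true) (fun _ => true) x y ↔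
      x ≠ y ∧ match x, y with
        | none, some _ => True
        | some i, some j => i.val + 1 = j.val
        | _, _ => False := by
    intro x y
    constructor
    · rintro (⟨i, -⟩ | ⟨i, -⟩)
      · simp
      · simp [Fin.ext_iff]
    · rcases x with _ | i <;> rcases y with _ | j
      · simp
      · exact fun _ => .spoke j rfl
      · simp
      · rintro ⟨-, h⟩
        simp only at h
        rw [show j = (⟨i.val, by omega⟩ : Fin m).succ from Fin.ext h.symm]
        exact .path ⟨i.val, by omega⟩ rfl
  rw [h, h, gadget, SimpleGraph.fromRel_adj, ne_comm (a := y)]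
  rcases x with _ | i <;> rcases y with _ | j <;> simp [and_or_left]

theorem gadgetRel_iff_edge {e : Fin 6} {v w : HollomVertex (m + 1)}
    {s : Fin (m + 1) → Bool} {p : Fin m → Bool} :
    (∃ x y, GadgetRel s p x y ∧ place (m + 1) e x = v ∧ place (m + 1) e y = w) ↔
      ∃ i, Sum.elim s p i = true ∧ edgeFst m (e, i) = v ∧ edgeSnd m (e, i) = w := by
  constructor
  · rintro ⟨x, y, ⟨i, hi⟩ | ⟨i, hi⟩, h₁, h₂⟩
    · exact ⟨.inl i, hi, h₁, h₂⟩
    · exact ⟨.inr i, hi, h₁, h₂⟩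
  · rintro ⟨i | i, hi, h₁, h₂⟩
    · exact ⟨_, _, .spoke i hi, h₁, h₂⟩
    · exact ⟨_, _, .path i hi, h₁, h₂⟩

theorem hollomGraph_adj {v w : HollomVertex (m + 1)} : (hollomGraph (m + 1)).Adj v w ↔
    ∃ x : EdgeIndex m, s(edgeFst m x, edgeSnd m x) = s(v, w) := by
  have h : ∀ v w : HollomVertex (m + 1), (∃ (e : Fin 6) (s t : Option (Fin (m + 1))),
      (gadget (m + 1)).Adj s t ∧ place (m + 1) e s = v ∧ place (m + 1) e t = w) ↔
      ∃ x : EdgeIndex m, s(edgeFst m x, edgeSnd m x) = s(v, w) := by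
    intro v w
    simp only [gadget_adj, Prod.exists, Sym2.eq_iff]
    refine exists_congr fun e => ?_
    simp only [or_and_right, exists_or]
    refine or_congr ?_ ?_
    · simpa using gadgetRel_iff_edge (e := e) (v := v) (w := w)
        (s := fun _ => true) (p := fun _ => true)
    · rw [exists_comm]
      simpa [and_comm] using
        gadgetRel_iff_edge (e := e) (v := w) (w := v) (s := fun _ => true) (p := fun _ => true)
  rw [hollomGraph, SimpleGraph.fromRel_adj, h, h, Sym2.eq_swap (a := w), or_self]
  refine ⟨And.right, fun h => ⟨?_, h⟩⟩
  rintro rfl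
  obtain ⟨x, hx⟩ := h
  have := edgeFst_ne x
  simp only [Sym2.eq_iff] at hx
  exact this (by rcases hx with hx | hx <;> rw [hx.1, hx.2])

theorem hollomGraph_edgeSet : (hollomGraph (m + 1)).edgeSet =
    Set.range fun x : EdgeIndex m => s(edgeFst m x, edgeSnd m x) := by
  ext z
  induction z using Sym2.ind with
  | _ v w => simp only [SimpleGraph.mem_edgeSet, hollomGraph_adj, Set.mem_range]

theorem hollomGraph_edgeSet_ncard (hm : 1 ≤ m) :
    (hollomGraph (m + 1)).edgeSet.ncard = 6 * (2 * m + 1) := by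
  rw [hollomGraph_edgeSet, ← Set.image_univ, Set.ncard_image_of_injective _ (edge_injective hm),
    Set.ncard_univ, Nat.card_eq_fintype_card]
  simp
  ring

theorem reachable_place (e : Fin 6) (x : Option (Fin (m + 1))) :
    (hollomGraph (m + 1)).Reachable (place (m + 1) e none) (place (m + 1) e x) := by
  rcases x with _ | i
  · exact .refl _
  · exact (hollomGraph_adj.2 ⟨(e, .inl i), rfl⟩).reachable

theorem hollomGraph_connected (hm : 1 ≤ m) : (hollomGraph (m + 1)).Connected := by
  have step : ∀ e e' : Fin 6, (hollomEdge e).2.2 = (hollomEdge e').2.1 →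
      (hollomGraph (m + 1)).Reachable (place (m + 1) e none) (place (m + 1) e' none) := by
    intro e e' h
    have h₁ := reachable_place e (some (Fin.last m))
    rw [place_last hm, h, ← place_zero] at h₁
    exact h₁.trans (reachable_place e' (some 0)).symm
  have h₁ := step 0 1 rfl
  have h₂ := h₁.trans (step 1 2 rfl)
  have h₃ := h₂.trans (step 2 3 rfl)
  have h₄ := h₃.trans (step 3 4 rfl)
  have h₅ := h₄.trans (step 4 5 rfl)
  rw [SimpleGraph.connected_iff_exists_forall_reachable]
  refine ⟨place (m + 1) 0 none, fun v => ?_⟩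
  obtain ⟨e, x, rfl⟩ := exists_place hm v
  refine SimpleGraph.Reachable.trans ?_ (reachable_place e x)
  fin_cases e
  exacts [.refl _, h₁, h₂, h₃, h₄, h₅]

/-! ### A planar drawing -/

/-- The height of the transversal vertex of a hyperedge. -/
def hubHeight : Fin 6 → ℝ := ![1, -2, -1, 1, -1, -2]

/-- The drawing: the long path lies on the horizontal axis, and the transversal vertices lie on its
perpendicular bisector. -/
noncomputable def drawing (m : ℕ) (v : HollomVertex (m + 1)) : ℝ × ℝ :=
  if vertexNum m v = -1 then ((7 * m / 2 : ℝ), 1) else if vertexNum m v = -2 then ((7 * m / 2 : ℝ), -1) else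
    if vertexNum m v = -3 then ((7 * m / 2 : ℝ), -2) else ((vertexNum m v : ℝ), 0)

theorem drawing_none (e : Fin 6) :
    drawing m (place (m + 1) e none) = ((7 * m / 2 : ℝ), hubHeight e) := by
  rw [drawing, vertexNum_place_none]
  fin_cases e <;> simp [hubNum, hubHeight]

theorem drawing_some (e : Fin 6) (i : Fin (m + 1)) :
    drawing m (place (m + 1) e (some i)) = ((e.val * m + i.val : ℝ), (0 : ℝ)) := by
  have : (0 : ℤ) ≤ e.val * m + i.val := by positivity
  rw [drawing, vertexNum_place_some, if_neg (by omega), if_neg (by omega), if_neg (by omega)]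
  push_cast
  rfl

/-- The last vertex of each path but the final one is the first vertex of the next path, so every
path vertex except u_10 has an index below m, as `path_index_unique` requires. -/
theorem place_some_cases (hm : 1 ≤ m) (e : Fin 6) (i : Fin (m + 1)) :
    (∃ e' : Fin 6, ∃ j : Fin m, place (m + 1) e (some i) = place (m + 1) e' (some j.castSucc)) ∨
      place (m + 1) e (some i) = place (m + 1) 5 (some (Fin.last m)) := by
  rcases Fin.eq_castSucc_or_eq_last i with ⟨j, rfl⟩ | rfl
  · exact .inl ⟨e, j, rfl⟩
  · have h : ∀ e' : Fin 6, (hollomEdge e).2.2 = (hollomEdge e').2.1 →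
        place (m + 1) e (some (Fin.last m)) = place (m + 1) e' (some (⟨0, hm⟩ : Fin m).castSucc) :=
      fun e' h => by rw [place_last hm, h]; rfl
    fin_cases e
    exacts [.inl ⟨1, _, h 1 rfl⟩, .inl ⟨2, _, h 2 rfl⟩, .inl ⟨3, _, h 3 rfl⟩, .inl ⟨4, _, h 4 rfl⟩,
      .inl ⟨5, _, h 5 rfl⟩, .inr rfl]

theorem drawing_injective (m : ℕ) (hm : 1 ≤ m) : Function.Injective (drawing m) := by
  have hinj : Function.Injective (vertexNum m) := by
    intro v w h
    obtain ⟨e, x, rfl⟩ := exists_place hm v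
    obtain ⟨e', y, rfl⟩ := exists_place hm w
    rcases x with _ | i <;> rcases y with _ | j <;>
      simp only [vertexNum_place_none, vertexNum_place_some] at h <;>
      have he := hubNum_neg e <;> have he' := hubNum_neg e'
    · rw [place_none, place_none]
      fin_cases e <;> fin_cases e' <;> simp [hubNum] at h <;> rfl
    · have : (0 : ℤ) ≤ e'.val * m + j.val := by positivity
      omega
    · have : (0 : ℤ) ≤ e.val * m + i.val := by positivity
      omega
    · have hlt : ∀ (e : Fin 6) (i : Fin m), (e.val * m + i.val : ℤ) ≠ (5 : Fin 6).val * m + m := by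
        intro e i h
        have hi := i.isLt
        fin_cases e <;> simp at h <;> omega
      rw [← vertexNum_place_some, ← vertexNum_place_some] at h
      rcases place_some_cases hm e i with ⟨e₁, i₁, h₁⟩ | h₁ <;>
        rcases place_some_cases hm e' j with ⟨e₂, i₂, h₂⟩ | h₂ <;>
        rw [h₁, h₂] at h ⊢ <;> simp only [vertexNum_place_some] at h
      · obtain ⟨rfl, h'⟩ := path_index_unique i₁.isLt i₂.isLt h
        rw [Fin.ext h']
      · exact absurd h (hlt _ _)
      · exact absurd h.symm (hlt _ _)
  intro v w h
  refine hinj ?_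
  unfold drawing at h
  split_ifs at h <;> simp at h
  all_goals first | omega | norm_num at h

/-- The straight arc of an edge. -/
noncomputable def drawnEdge (m : ℕ) (x : EdgeIndex m) (t : unitInterval) : ℝ × ℝ :=
  AffineMap.lineMap (drawing m (edgeFst m x)) (drawing m (edgeSnd m x)) (t : ℝ)

theorem drawnEdge_spoke (e : Fin 6) (i : Fin (m + 1)) (t : unitInterval) :
    drawnEdge m (e, .inl i) t = ((7 * m / 2 + t * (e.val * m + i.val - 7 * m / 2) : ℝ),
      ((1 - t) * hubHeight e : ℝ)) := by
  rw [drawnEdge, edgeFst, edgeSnd, drawing_none, drawing_some, AffineMap.lineMap_apply]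
  ext <;> simp <;> ring

theorem drawnEdge_path (e : Fin 6) (i : Fin m) (t : unitInterval) :
    drawnEdge m (e, .inr i) t = ((e.val * m + i.val + t : ℝ), (0 : ℝ)) := by
  rw [drawnEdge, edgeFst, edgeSnd, drawing_some, drawing_some, AffineMap.lineMap_apply]
  ext
  · simp
    ring
  · simp

theorem hubHeight_ne_zero (e : Fin 6) : hubHeight e ≠ 0 := by
  fin_cases e <;> simp [hubHeight]

/-- The spokes of u_2 lie above the axis, those of u_7 and u_9 below it. The abscissa 7m/2 is the
centre of the stretch from 2m to 5m: the paths of u_7 lie inside this stretch and those of u_9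
outside, so the fan of u_9 passes around that of u_7. -/
theorem hubHeight_cases (e : Fin 6) :
    (hubHeight e = 1 ∧ hubNum e = -1) ∨
    (hubHeight e = -1 ∧ hubNum e = -2 ∧ ∀ i : Fin (m + 1),
      |(e.val * m + i.val - 7 * m / 2 : ℝ)| ≤ 3 * m / 2) ∨
    (hubHeight e = -2 ∧ hubNum e = -3 ∧ ∀ i : Fin (m + 1),
      3 * m / 2 ≤ |(e.val * m + i.val - 7 * m / 2 : ℝ)|) := by
  have hi : ∀ i : Fin (m + 1), (i.val : ℝ) ≤ m := fun i => by exact_mod_cast i.is_le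
  have hi' : ∀ i : Fin (m + 1), (0 : ℝ) ≤ i.val := fun i => by positivity
  have hm : (0 : ℝ) ≤ m := by positivity
  fin_cases e
  · exact .inl ⟨rfl, rfl⟩
  · refine .inr (.inr ⟨rfl, rfl, fun i => le_abs.2 (.inr ?_)⟩)
    simp
    linarith [hi i]
  · refine .inr (.inl ⟨rfl, rfl, fun i => abs_le.2 ⟨?_, ?_⟩⟩) <;> simp <;> linarith [hi i, hi' i]
  · exact .inl ⟨rfl, rfl⟩
  · refine .inr (.inl ⟨rfl, rfl, fun i => abs_le.2 ⟨?_, ?_⟩⟩) <;> simp <;> linarith [hi i, hi' i]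
  · refine .inr (.inr ⟨rfl, rfl, fun i => le_abs.2 (.inl ?_)⟩)
    simp
    linarith [hi' i]

theorem drawnEdge_ne_drawing (hm : 1 ≤ m) (x : EdgeIndex m) (t : unitInterval) (h0 : 0 < t)
    (h1 : t < 1) (v : HollomVertex (m + 1)) : drawnEdge m x t ≠ drawing m v := by
  obtain ⟨e', y, rfl⟩ := exists_place hm v
  have h0 : (0 : ℝ) < t := h0
  have h1 : (t : ℝ) < 1 := h1
  have hm' : (1 : ℝ) ≤ m := by exact_mod_cast hm
  rcases x with ⟨e, i | i⟩ <;> rcases y with _ | j <;>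
    simp only [drawnEdge_spoke, drawnEdge_path, drawing_none, drawing_some, ne_eq, Prod.mk.injEq,
      not_and]
  · intro hx
    -- The spoke is vertical. This is impossible for u_9; from heights 1 and -1 the interior of the
    -- spoke approaches the axis and misses all three hubs.
    have hx : (e.val * m + i.val - 7 * m / 2 : ℝ) = 0 := by
      have : (t : ℝ) * (e.val * m + i.val - 7 * m / 2) = 0 := by linarith
      exact (mul_eq_zero.1 this).resolve_left h0.ne'
    rcases hubHeight_cases (m := m) e with ⟨h, -⟩ | ⟨h, -⟩ | ⟨-, -, h⟩
    · rcases hubHeight_cases (m := m) e' with ⟨h', -⟩ | ⟨h', -⟩ | ⟨h', -⟩ <;> rw [h, h'] <;>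
        intro <;> linarith
    · rcases hubHeight_cases (m := m) e' with ⟨h', -⟩ | ⟨h', -⟩ | ⟨h', -⟩ <;> rw [h, h'] <;>
        intro <;> linarith
    · have := h i
      rw [hx, abs_zero] at this
      linarith
  · intro _
    exact mul_ne_zero (by linarith) (hubHeight_ne_zero e)
  · exact fun _ => (hubHeight_ne_zero e').symm
  · intro hx
    have h2 : (((e.val * m + i.val : ℤ) : ℝ)) < ((e'.val * m + j.val : ℤ) : ℝ) := by
      push_cast
      linarith
    have h3 : ((e'.val * m + j.val : ℤ) : ℝ) < ((e.val * m + i.val + 1 : ℤ) : ℝ) := by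
      push_cast
      linarith
    have h2 := Int.cast_lt.1 h2
    have h3 := Int.cast_lt.1 h3
    omega

/-- Equal heights force t = (1 + s)/2 > s, so the spoke of u_9 is strictly farther from the central
line than that of u_7. -/
theorem spoke_ne_spoke_of_height (hm : 1 ≤ m) {c c' s t : ℝ} (hs : s < 1) (ht : 0 < t)
    (hc : |c| ≤ 3 * m / 2) (hc' : 3 * m / 2 ≤ |c'|) (h : s * c = t * c')
    (hh : (1 - s) * -1 = (1 - t) * -2) (hs0 : 0 < s) : False := by
  have hm' : (1 : ℝ) ≤ m := by exact_mod_cast hm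
  have h1 : s * |c| = t * |c'| := by
    rw [← abs_of_pos hs0, ← abs_of_pos ht, ← abs_mul, ← abs_mul, h]
  nlinarith

theorem drawnEdge_ne_drawnEdge (hm : 1 ≤ m) (x y : EdgeIndex m) (hxy : x ≠ y)
    (s t : unitInterval) (hs0 : 0 < s) (hs1 : s < 1) (ht0 : 0 < t) (ht1 : t < 1) :
    drawnEdge m x s ≠ drawnEdge m y t := by
  have hs0 : (0 : ℝ) < s := hs0
  have hs1 : (s : ℝ) < 1 := hs1
  have ht0 : (0 : ℝ) < t := ht0
  have ht1 : (t : ℝ) < 1 := ht1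
  rcases x with ⟨e, i | i⟩ <;> rcases y with ⟨e', j | j⟩ <;>
    simp only [drawnEdge_spoke, drawnEdge_path, ne_eq, Prod.mk.injEq, not_and]
  · intro hx hy
    have hx : (s : ℝ) * (e.val * m + i.val - 7 * m / 2) =
        t * (e'.val * m + j.val - 7 * m / 2) := by linarith
    have same : hubHeight e = hubHeight e' → hubNum e = hubNum e' → False := by
      intro h hub
      rw [h] at hy
      have hst : (s : ℝ) = t := by
        have := mul_right_cancel₀ (hubHeight_ne_zero e') hy
        linarith
      rw [hst] at hx
      have hx := mul_left_cancel₀ ht0.ne' hx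
      have hx : ((e.val * m + i.val : ℤ) : ℝ) = ((e'.val * m + j.val : ℤ) : ℝ) := by
        push_cast
        linarith
      obtain ⟨rfl, hij⟩ := spoke_index_unique hm i.is_le j.is_le hub (Int.cast_injective hx)
      exact hxy (congrArg (fun i => (e, Sum.inl i)) (Fin.ext hij))
    rcases hubHeight_cases (m := m) e with ⟨h, hub⟩ | ⟨h, hub, hc⟩ | ⟨h, hub, hc⟩ <;>
      rcases hubHeight_cases (m := m) e' with ⟨h', hub'⟩ | ⟨h', hub', hc'⟩ | ⟨h', hub', hc'⟩
    · exact same (h.trans h'.symm) (hub.trans hub'.symm)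
    · rw [h, h'] at hy
      linarith
    · rw [h, h'] at hy
      linarith
    · rw [h, h'] at hy
      linarith
    · exact same (h.trans h'.symm) (hub.trans hub'.symm)
    · rw [h, h'] at hy
      exact spoke_ne_spoke_of_height hm hs1 ht0 (hc i) (hc' j) hx hy hs0
    · rw [h, h'] at hy
      linarith
    · rw [h, h'] at hy
      exact spoke_ne_spoke_of_height hm ht1 hs0 (hc' j) (hc i) hx.symm hy.symm ht0
    · exact same (h.trans h'.symm) (hub.trans hub'.symm)
  · exact fun _ => mul_ne_zero (by linarith) (hubHeight_ne_zero e)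
  · exact fun _ h => mul_ne_zero (by linarith) (hubHeight_ne_zero e') h.symm
  · intro hx
    have h2 : ((e.val * m + i.val : ℤ) : ℝ) < ((e'.val * m + j.val + 1 : ℤ) : ℝ) := by
      push_cast
      linarith
    have h3 : ((e'.val * m + j.val : ℤ) : ℝ) < ((e.val * m + i.val + 1 : ℤ) : ℝ) := by
      push_cast
      linarith
    have h2 := Int.cast_lt.1 h2
    have h3 := Int.cast_lt.1 h3
    obtain ⟨rfl, h⟩ := path_index_unique i.isLt j.isLt
      (show (e.val * m + i.val : ℤ) = e'.val * m + j.val by omega)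
    exact absurd (congrArg (fun i => (e, Sum.inr i)) (Fin.ext h)) hxy

theorem hollomGraph_isPlanar (hm : 1 ≤ m) : IsPlanar (hollomGraph (m + 1)) := by
  have hidx : ∀ z : (hollomGraph (m + 1)).edgeSet,
      ∃ x : EdgeIndex m, s(edgeFst m x, edgeSnd m x) = z.1 := by
    rintro ⟨z, hz⟩
    rwa [hollomGraph_edgeSet] at hz
  choose idx hidx using hidx
  have hinj := drawing_injective m hm
  refine ⟨drawing m, fun z => drawnEdge m (idx z), hinj, fun z => ?_, fun z => ?_, fun z => ?_,
    fun z t h0 h1 v => drawnEdge_ne_drawing hm _ t h0 h1 v, fun z w hzw s t hs0 hs1 ht0 ht1 =>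
      drawnEdge_ne_drawnEdge hm _ _ (fun h => hzw ?_) s t hs0 hs1 ht0 ht1⟩
  · exact AffineMap.lineMap_continuous.comp continuous_subtype_val
  · exact (AffineMap.lineMap_injective ℝ (hinj.ne (edgeFst_ne _))).comp Subtype.val_injective
  · rw [← hidx z]
    simp [drawnEdge]
  · apply Subtype.ext
    rw [← hidx z, ← hidx w, h]
end

/-! ## Reduction of the bunkbed graph -/

section

variable {m : ℕ}

/-- The edges of the two copies of the graph. -/
def levelEdge (m : ℕ) (x : EdgeIndex m × Bool) : Sym2 (HollomVertex (m + 1) × Bool) :=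
  s((edgeFst m x.1, x.2), (edgeSnd m x.1, x.2))

theorem levelEdge_injective (hm : 1 ≤ m) : Function.Injective (levelEdge m) := by
  rintro ⟨x, i⟩ ⟨y, j⟩ h
  have h₁ : x = y := by
    have := congrArg (Sym2.map Prod.fst) h
    exact edge_injective hm (by simpa [levelEdge] using this)
  simp only [levelEdge, Sym2.eq_iff, Prod.mk.injEq] at h
  rw [h₁, show i = j by tauto]

theorem levelEdges_hollomGraph :
    levelEdges (hollomGraph (m + 1)) = Set.range (levelEdge m) := by
  ext z
  simp only [levelEdges, hollomGraph_edgeSet, Set.mem_range, Set.mem_ofPred_eq]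
  constructor
  · rintro ⟨_, ⟨x, rfl⟩, i, rfl⟩
    exact ⟨(x, i), by simp [levelEdge]⟩
  · rintro ⟨⟨x, i⟩, rfl⟩
    exact ⟨_, ⟨x, rfl⟩, i, by simp [levelEdge]⟩

/-- The bunkbed graph with the level edges retained by `ω`. -/
def openGraph (ω : EdgeIndex m × Bool → Bool) : SimpleGraph (HollomVertex (m + 1) × Bool) :=
  retainedGraph (hollomT (m + 1)) (levelEdge m '' {x | ω x = true})

/-- The retained spokes of a copy of a gadget. -/
def openSpokes (ω : EdgeIndex m × Bool → Bool) (e : Fin 6) (i : Bool) : Fin (m + 1) → Bool :=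
  fun j => ω ((e, .inl j), i)

/-- The retained path edges of a copy of a gadget. -/
def openPath (ω : EdgeIndex m × Bool → Bool) (e : Fin 6) (i : Bool) : Fin m → Bool :=
  fun j => ω ((e, .inr j), i)

/-- The retained edges of a copy of a gadget. -/
abbrev OpenRel (ω : EdgeIndex m × Bool → Bool) (e : Fin 6) (i : Bool) :
    Option (Fin (m + 1)) → Option (Fin (m + 1)) → Prop :=
  GadgetRel (openSpokes ω e i) (openPath ω e i)

/-- The state of a copy of a gadget. -/
noncomputable def openState (ω : EdgeIndex m × Bool → Bool) (e : Fin 6) (i : Bool) : TriState :=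
  triState (openSpokes ω e i) (openPath ω e i)

/-- The joins of the hyperedges. -/
noncomputable def openJoins (ω : EdgeIndex m × Bool → Bool) (e : Fin 6) : Joins :=
  TwistedState.joins ((openState ω e false, openState ω e true), false)

/-- The lower level at the transversal vertices. -/
def collapse (x : Fin 10 × Bool) : Fin 10 × Bool :=
  (x.1, x.2 && !(x.1 == 1 || x.1 == 6 || x.1 == 8))

theorem collapse_transversal (e : Fin 6) (i : Bool) :
    collapse ((hollomEdge e).1, i) = ((hollomEdge e).1, false) := by
  fin_cases e <;> cases i <;> rfl

theorem collapse_left (e : Fin 6) (i : Bool) :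
    collapse ((hollomEdge e).2.1, i) = ((hollomEdge e).2.1, i) := by
  fin_cases e <;> cases i <;> rfl

theorem collapse_right (e : Fin 6) (i : Bool) :
    collapse ((hollomEdge e).2.2, i) = ((hollomEdge e).2.2, i) := by
  fin_cases e <;> cases i <;> rfl

variable {ω : EdgeIndex m × Bool → Bool}

theorem openJoins_ab {e : Fin 6} {i : Bool} : (openJoins ω e).ab i = true ↔
    LeftJoined (openSpokes ω e i) (openPath ω e i) := by
  rw [← triState_left]
  cases i <;> rfl

theorem openJoins_ac {e : Fin 6} {i : Bool} : (openJoins ω e).ac i = true ↔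
    RightJoined (openSpokes ω e i) (openPath ω e i) := by
  rw [← triState_right]
  cases i <;> rfl

theorem openJoins_bc {e : Fin 6} {i j : Bool} : (openJoins ω e).bc i j = true ↔
    i = j ∧ openState ω e i = none := by
  cases i <;> cases j <;> simp [openJoins, TwistedState.joins, Joins.bc]

theorem place_eq_inl (hm : 1 ≤ m) {e : Fin 6} {x : Option (Fin (m + 1))} {u : Fin 10}
    (h : place (m + 1) e x = Sum.inl u) : (x = none ∧ u = (hollomEdge e).1) ∨
      (x = some 0 ∧ u = (hollomEdge e).2.1) ∨
      (x = some (Fin.last m) ∧ u = (hollomEdge e).2.2) := by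
  rcases x with _ | i
  · exact .inl ⟨rfl, (Sum.inl_injective h).symm⟩
  by_cases h₁ : i.val = 0
  · obtain rfl : i = 0 := Fin.ext h₁
    exact .inr (.inl ⟨rfl, (Sum.inl_injective h).symm⟩)
  by_cases h₂ : i.val = m
  · obtain rfl : i = Fin.last m := Fin.ext h₂
    rw [place_last hm] at h
    exact .inr (.inr ⟨rfl, (Sum.inl_injective h).symm⟩)
  · simp [place, h₁, h₂] at h

/-- Connections inside one copy of a gadget are seen by the reduced graph. If b and c are joined
through a, two joins are needed, since `bc` records only the state `none`. -/
theorem eqvGen_openJoins_of_terminals (hm : 1 ≤ m) {e : Fin 6} {i : Bool}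
    {x y : Option (Fin (m + 1))} {u v : Fin 10} (hx : place (m + 1) e x = Sum.inl u)
    (hy : place (m + 1) e y = Sum.inl v) (hxy : Relation.EqvGen (OpenRel ω e i) x y) :
    Relation.EqvGen (JoinRel (openJoins ω)) (collapse (u, i)) (collapse (v, i)) := by
  have hab : Relation.EqvGen (OpenRel ω e i) none (some 0) →
      Relation.EqvGen (JoinRel (openJoins ω)) ((hollomEdge e).1, false) ((hollomEdge e).2.1, i) :=
    fun h => .rel _ _ (.ab e i (openJoins_ab.2 (eqvGen_none_zero.1 h)))
  have hac : Relation.EqvGen (OpenRel ω e i) none (some (Fin.last m)) →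
      Relation.EqvGen (JoinRel (openJoins ω)) ((hollomEdge e).1, false) ((hollomEdge e).2.2, i) :=
    fun h => .rel _ _ (.ac e i (openJoins_ac.2 (eqvGen_none_last.1 h)))
  have hbc : Relation.EqvGen (OpenRel ω e i) (some 0) (some (Fin.last m)) →
      Relation.EqvGen (JoinRel (openJoins ω)) ((hollomEdge e).2.1, i) ((hollomEdge e).2.2, i) := by
    intro h
    rcases eqvGen_zero_last.1 h with ⟨hl, hr⟩ | h
    · exact ((hab (eqvGen_none_zero.2 hl)).symm _ _).trans _ _ _ (hac (eqvGen_none_last.2 hr))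
    · exact .rel _ _ (.bc e i i (openJoins_bc.2 ⟨rfl, h⟩))
  rcases place_eq_inl hm hx with ⟨rfl, rfl⟩ | ⟨rfl, rfl⟩ | ⟨rfl, rfl⟩ <;>
    rcases place_eq_inl hm hy with ⟨rfl, rfl⟩ | ⟨rfl, rfl⟩ | ⟨rfl, rfl⟩ <;>
    simp only [collapse_transversal, collapse_left, collapse_right]
  · exact .refl _
  · exact hab hxy
  · exact hac hxy
  · exact (hab (hxy.symm _ _)).symm _ _
  · exact .refl _
  · exact hbc hxy
  · exact (hac (hxy.symm _ _)).symm _ _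
  · exact (hbc (hxy.symm _ _)).symm _ _
  · exact .refl _

/-- The vertices joined to a terminal in the component of `u_1`. -/
def InComponent (ω : EdgeIndex m × Bool → Bool) : HollomVertex (m + 1) × Bool → Prop
  | (.inl u, i) => Relation.EqvGen (JoinRel (openJoins ω)) (0, false) (collapse (u, i))
  | (.inr (e, k), i) => ∃ x u, place (m + 1) e x = Sum.inl u ∧
      Relation.EqvGen (JoinRel (openJoins ω)) (0, false) (collapse (u, i)) ∧
      Relation.EqvGen (OpenRel ω e i) x (some ⟨k.val + 1, by omega⟩)

/-- The description of interior vertices also holds at terminals, because terminals connected inside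
a copy are connected in the reduced graph. This makes the component closed under retained edges. -/
theorem inComponent_place (hm : 1 ≤ m) (e : Fin 6) (y : Option (Fin (m + 1))) (i : Bool) :
    InComponent ω (place (m + 1) e y, i) ↔ ∃ x u, place (m + 1) e x = Sum.inl u ∧
      Relation.EqvGen (JoinRel (openJoins ω)) (0, false) (collapse (u, i)) ∧
      Relation.EqvGen (OpenRel ω e i) x y := by
  rcases hy : place (m + 1) e y with v | ⟨e', k⟩
  · constructor
    · exact fun h => ⟨y, v, hy, h, .refl _⟩
    · rintro ⟨x, u, hx, hu, hxy⟩
      exact hu.trans _ _ _ (eqvGen_openJoins_of_terminals hm hx hy hxy)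
  · have : e' = e ∧ y = some ⟨k.val + 1, by omega⟩ := by
      rcases y with _ | j
      · simp [place] at hy
      · simp only [place] at hy
        split_ifs at hy with h₁ h₂
        simp only [Sum.inr.injEq, Prod.mk.injEq] at hy
        refine ⟨hy.1.symm, ?_⟩
        rw [Option.some.injEq, Fin.ext_iff, ← hy.2]
        simp only
        omega
    obtain ⟨rfl, rfl⟩ := this
    rfl

theorem openGraph_adj {v w : HollomVertex (m + 1) × Bool} : (openGraph ω).Adj v w ↔
    ((∃ x, ω x = true ∧ levelEdge m x = s(v, w)) ∨
      ∃ u ∈ hollomT (m + 1), s(v, w) = s((u, false), (u, true))) ∧ v ≠ w := by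
  rw [openGraph, retainedGraph, SimpleGraph.fromEdgeSet_adj]
  rfl

theorem inComponent_of_openRel (hm : 1 ≤ m) {e : Fin 6} {i : Bool} {x y : Option (Fin (m + 1))}
    (h : Relation.EqvGen (OpenRel ω e i) x y) :
    InComponent ω (place (m + 1) e x, i) ↔ InComponent ω (place (m + 1) e y, i) := by
  rw [inComponent_place hm, inComponent_place hm]
  exact exists_congr fun z => exists_congr fun u => and_congr_right fun _ => and_congr_right fun _ =>
    ⟨fun h' => h'.trans _ _ _ h, fun h' => h'.trans _ _ _ (h.symm _ _)⟩

theorem openRel_of_open {e : Fin 6} {j : Fin (m + 1) ⊕ Fin m} {i : Bool}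
    (h : ω ((e, j), i) = true) : ∃ x y, OpenRel ω e i x y ∧
      place (m + 1) e x = edgeFst m (e, j) ∧ place (m + 1) e y = edgeSnd m (e, j) := by
  refine gadgetRel_iff_edge.2 ⟨j, ?_, rfl, rfl⟩
  rcases j with j | j <;> exact h

theorem inComponent_of_adj (hm : 1 ≤ m) {v w : HollomVertex (m + 1) × Bool}
    (h : (openGraph ω).Adj v w) : InComponent ω v ↔ InComponent ω w := by
  rcases (openGraph_adj.1 h).1 with ⟨⟨⟨e, j⟩, i⟩, hx, h⟩ | ⟨u, hu, h⟩
  · obtain ⟨x, y, hxy, h₁, h₂⟩ := openRel_of_open hx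
    have key := inComponent_of_openRel hm (.rel _ _ hxy)
    rw [h₁, h₂] at key
    simp only [levelEdge, Sym2.eq_iff] at h
    rcases h with ⟨rfl, rfl⟩ | ⟨rfl, rfl⟩
    · exact key
    · exact key.symm
  · have key : InComponent ω (u, false) ↔ InComponent ω (u, true) := by
      simp only [hollomT, Set.mem_insert_iff, Set.mem_singleton_iff] at hu
      rcases hu with rfl | rfl | rfl <;> rfl
    simp only [Sym2.eq_iff] at h
    rcases h with ⟨rfl, rfl⟩ | ⟨rfl, rfl⟩
    · exact key
    · exact key.symm

theorem reachable_of_openRel {e : Fin 6} {i : Bool} {x y : Option (Fin (m + 1))}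
    (h : Relation.EqvGen (OpenRel ω e i) x y) :
    (openGraph ω).Reachable (place (m + 1) e x, i) (place (m + 1) e y, i) := by
  induction h with
  | rel x y h =>
    obtain ⟨j, hj, h₁, h₂⟩ := gadgetRel_iff_edge.1 ⟨x, y, h, rfl, rfl⟩
    rw [← h₁, ← h₂]
    refine (openGraph_adj.2 ⟨.inl ⟨((e, j), i), ?_, rfl⟩, ?_⟩).reachable
    · rcases j with j | j <;> exact hj
    · exact fun h => edgeFst_ne _ (congrArg Prod.fst h)
  | refl x => exact .refl _
  | symm x y _ ih => exact ih.symm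
  | trans x y z _ _ ih₁ ih₂ => exact ih₁.trans ih₂

theorem reachable_post (e : Fin 6) (i : Bool) : (openGraph ω).Reachable
    (Sum.inl (hollomEdge e).1, false) (Sum.inl (hollomEdge e).1, i) := by
  cases i
  · exact .refl _
  · refine (openGraph_adj.2 ⟨.inr ⟨_, ?_, rfl⟩, by simp⟩).reachable
    fin_cases e <;> simp [hollomT, hollomEdge]

theorem reachable_of_eqvGen (hm : 1 ≤ m) {x y : Fin 10 × Bool}
    (h : Relation.EqvGen (JoinRel (openJoins ω)) x y) :
    (openGraph ω).Reachable (Sum.inl x.1, x.2) (Sum.inl y.1, y.2) := by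
  induction h with
  | rel x y h =>
    rcases h with ⟨e, i, h⟩ | ⟨e, i, h⟩ | ⟨e, i, j, h⟩
    · exact (reachable_post e i).trans
        (reachable_of_openRel (eqvGen_none_zero.2 (openJoins_ab.1 h)))
    · have := reachable_of_openRel (eqvGen_none_last.2 (openJoins_ac.1 h))
      rw [place_last hm] at this
      exact (reachable_post e i).trans this
    · obtain ⟨rfl, h'⟩ := openJoins_bc.1 h
      have := reachable_of_openRel (eqvGen_zero_last.2 (.inr h'))
      rwa [place_last hm] at this
  | refl x => exact .refl _
  | symm x y _ ih => exact ih.symm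
  | trans x y z _ _ ih₁ ih₂ => exact ih₁.trans ih₂

theorem reachable_iff_eqvGen (hm : 1 ≤ m) (j : Bool) :
    (openGraph ω).Reachable (Sum.inl 0, false) (Sum.inl 9, j) ↔
      Relation.EqvGen (JoinRel (openJoins ω)) (0, false) (9, j) := by
  constructor
  · rintro ⟨p⟩
    have : ∀ v w, (openGraph ω).Walk v w → (InComponent ω v ↔ InComponent ω w) := by
      intro v w p
      induction p with
      | nil => rfl
      | cons h _ ih => exact (inComponent_of_adj hm h).trans ih
    have := (this _ _ p).1 (Relation.EqvGen.refl _)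
    simpa [InComponent, collapse] using this
  · exact reachable_of_eqvGen hm

/-! ## The difference of the two probabilities -/

/-- The configurations as independent configurations of the twelve gadgets. -/
def splitConfig (m : ℕ) : (Fin 6 → ((Fin (m + 1) → Bool) × (Fin m → Bool)) ×
    ((Fin (m + 1) → Bool) × (Fin m → Bool))) ≃ (EdgeIndex m × Bool → Bool) where
  toFun c x := match x with
    | ((e, j), i) => Sum.elim (bif i then (c e).2.1 else (c e).1.1)
      (bif i then (c e).2.2 else (c e).1.2) j
  invFun ω e := ((openSpokes ω e false, openPath ω e false),
    (openSpokes ω e true, openPath ω e true))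
  left_inv c := rfl
  right_inv ω := by
    funext ⟨⟨e, j⟩, i⟩
    rcases j with j | j <;> cases i <;> rfl

open Classical in
theorem bunkbedProb_eq_sum (hm : 1 ≤ m) {p : unitInterval} (hp : (p : ℝ) = 1 / 2) (j : Bool) :
    bunkbedProb (hollomGraph (m + 1)) (hollomT (m + 1)) p (Sum.inl 0, false) (Sum.inl 9, j) =
      (∑ ω : EdgeIndex m × Bool → Bool,
        if Relation.EqvGen (JoinRel (openJoins ω)) (0, false) (9, j) then 1 else 0) /
        2 ^ (12 * (2 * m + 1)) := by
  rw [bunkbedProb, levelEdges_hollomGraph, setBernoulli_half_real (levelEdge_injective hm) hp]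
  congr 1
  · refine Finset.sum_congr rfl fun ω _ => if_congr ?_ rfl rfl
    exact reachable_iff_eqvGen hm j
  · congr 1
    simp
    ring

theorem bunkbedProb_sub (hm : 1 ≤ m) {p : unitInterval} (hp : (p : ℝ) = 1 / 2) :
    bunkbedProb (hollomGraph (m + 1)) (hollomT (m + 1)) p (Sum.inl 0, false) (Sum.inl 9, false) -
      bunkbedProb (hollomGraph (m + 1)) (hollomT (m + 1)) p (Sum.inl 0, false) (Sum.inl 9, true) =
      meanExcess (triDist m) := by
  rw [bunkbedProb_eq_sum hm hp, bunkbedProb_eq_sum hm hp, ← sub_div, ← Finset.sum_sub_distrib]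
  calc _ = (∑ c, excess (openJoins (splitConfig m c))) / 2 ^ (12 * (2 * m + 1)) := by
        rw [(splitConfig m).sum_comp fun ω => excess (openJoins ω)]
        rfl
    _ = ∑ c : Fin 6 → ((Fin (m + 1) → Bool) × (Fin m → Bool)) ×
        ((Fin (m + 1) → Bool) × (Fin m → Bool)), (∏ _e : Fin 6, 1 / 2 ^ (2 * (2 * m + 1)) : ℝ) *
          excess fun e => TwistedState.joins
            ((triState (c e).1.1 (c e).1.2, triState (c e).2.1 (c e).2.2), false) := by
        rw [← Finset.mul_sum, div_eq_inv_mul]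
        congr 1
        rw [Finset.prod_const, Finset.card_univ, Fintype.card_fin, one_div, inv_pow, ← pow_mul]
        congr 2
        ring
    _ = _ := by
        -- The uniform weight on the configurations of one hyperedge and the product of two copies
        -- of `triDist m` induce the same law on joins.
        refine sum_pi_prod_congr
          (w := fun _ : ((Fin (m + 1) → Bool) × (Fin m → Bool)) ×
            ((Fin (m + 1) → Bool) × (Fin m → Bool)) => (1 / 2 ^ (2 * (2 * m + 1)) : ℝ))
          (w' := fun s : TriState × TriState => triDist m s.1 * triDist m s.2)
          (loc := fun c => TwistedState.joins
            ((triState c.1.1 c.1.2, triState c.2.1 c.2.2), false))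
          (loc' := fun s : TriState × TriState => TwistedState.joins (s, false)) (fun g => ?_) excess
        simp only [Fintype.sum_prod_type, mul_assoc, ← Finset.mul_sum, sum_triDist_mul]
        simp only [← Finset.sum_div]
        ring
end

theorem hollomGraph_bunkbedProb_lt {m : ℕ} (hm : 1203 ≤ m) {p : unitInterval}
    (hp : (p : ℝ) = 1 / 2) :
    bunkbedProb (hollomGraph (m + 1)) (hollomT (m + 1)) p (Sum.inl 0, false) (Sum.inl 9, false) <
      bunkbedProb (hollomGraph (m + 1)) (hollomT (m + 1)) p
        (Sum.inl 0, false) (Sum.inl 9, true) := by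
  rw [← sub_neg, bunkbedProb_sub (by omega) hp]
  obtain ⟨h₁, -, -, -, h₂⟩ := triDist_bounds m
  refine meanExcess_neg (triDist_nonneg m) (sum_triDist m) h₁ (le_trans ?_ h₂)
  have hm' : (1203 : ℝ) ≤ m := by exact_mod_cast hm
  -- For m ≥ 1203 the factor m/3 - 1/6 is at least 401 - 1/6, which exceeds 400.
  exact mul_le_mul_of_nonneg_right (by linarith) h₁.le

theorem theorem1p2 :
    ((hollomGraph 1204).Connected ∧
      IsPlanar (hollomGraph 1204) ∧
      Nat.card (HollomVertex 1204) = 7222 ∧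
      (hollomGraph 1204).edgeSet.ncard = 14442 ∧
      (hollomT 1204).ncard = 3 ∧
      bunkbedProb (hollomGraph 1204) (hollomT 1204) ⟨1 / 2, by norm_num, by norm_num⟩
          (Sum.inl 0, false) (Sum.inl 9, false) <
        bunkbedProb (hollomGraph 1204) (hollomT 1204) ⟨1 / 2, by norm_num, by norm_num⟩
          (Sum.inl 0, false) (Sum.inl 9, true)) ∧
    ¬ BunkbedConjecture := by
  have hconn : (hollomGraph 1204).Connected := hollomGraph_connected (m := 1203) (by norm_num)
  have hlt := hollomGraph_bunkbedProb_lt (m := 1203) le_rfl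
    (p := ⟨1 / 2, by norm_num, by norm_num⟩) rfl
  refine ⟨⟨hconn, hollomGraph_isPlanar (m := 1203) (by norm_num), ?_,
    hollomGraph_edgeSet_ncard (m := 1203) (by norm_num), ?_, hlt⟩, fun h => ?_⟩
  · rw [Nat.card_eq_fintype_card]
    simp
  · rw [hollomT, Set.ncard_insert_of_notMem (by simp), Set.ncard_pair (by simp)]
  · exact absurd (h _ _ hconn (hollomT 1204) ⟨1 / 2, by norm_num, by norm_num⟩
      (Subtype.mk_lt_mk.2 (by norm_num)) (Subtype.mk_lt_mk.2 (by norm_num)) _ _) (not_le.2 hlt)
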